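/- \textbf{Theorem.} Let $G$ be a circle graph on $n$ vertices, given with a representation by chords of a circle: every vertex is assigned a chord, and two different vertices are adjacent if and only if their chords intersect. Let $s,t$ be vertices of $G$. An \emph{$s$--$t$ shortest path} is a sequence $P=(s=v_0,v_1,\dots,v_d=t)$ of successively adjacent vertices with $d=d(s,t)$. Two $s$--$t$ shortest paths $P,Q$ are \emph{reconfigurable} if there are $s$--$t$ shortest paths $P=P_0,P_1,\dots,P_k=Q$ ($k\ge 0$) such that $P_j$ and $P_{j+1}$ differ in exactly one vertex for each $j<k$. \emph{Orientation.} For $0<i<d$, orient the chord of $v_i$ from its intersection point with the chord of $v_{i-1}$ to its intersection point with the chord of $v_{i+1}$; this determines its first and its second end point. \emph{Labels.} Fix an equator, i.e. an additional chord of the circle that intersects the chords of $s$ and $t$. If $d\ge 2$, then the chords of $s$ and $t$ are disjoint. Give a point $x$ of the circle the letter $S_s$ if it lies on the chord of $s$ or is separated by it from the chord of $t$; the letter $S_t$ if it lies on the chord of $t$ or is separated by it from the chord of $s$; and otherwise the letter $T$ or $B$ according to whether it lies above or below the equator. The label of an inner vertex of the path is the pair (letter of the first end point, letter of the second end point) of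 its chord, and the label of the path is the string of the labels of $v_1,\dots,v_{d-1}$. (All letters are $T$ or $B$, except for the first end point of $v_1$, which is $S_s$, and the second end point of $v_{d-1}$, which is $S_t$.) Then the following holds. \begin{enumerate} \item The orientation of a chord is well defined: it does not depend on the $s$--$t$ shortest path through the vertex. \item For every choice of the equator, two $s$--$t$ shortest paths $P$ and $Q$ are reconfigurable if and only if they have the same label. \item If $P$ and $Q$ are reconfigurable, then there is a reconfiguration sequence with $k=O(n)$ steps. \item There is an algorithm which, given the circular order of the chord end points and two $s$--$t$ shortest paths $P$ and $Q$, decides in time $O(n)$ on a unit-cost random access machine (whose registers and array entries are numbers of $O(\log n)$ bits) whether $P$ and $Q$ are reconfigurable and, if they are, outputs a reconfiguration sequence from $P$ to $Q$, given as the list of its steps (the position in which the path is changed, and the new vertex there). \end{enumerate} The constants in the $O(n)$ are absolute. -/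

import Mathlib

namespace CircleSPR

noncomputable section

/-! ### Chords of a circle and circle graphs -/

/-- The chord of the unit circle with end points `p` and `q`, as a set of points of the plane. -/
def chord (p q : Circle) : Set ℂ := segment ℝ (p : ℂ) (q : ℂ)

/-- A circle representation of the graph `G`: every vertex is assigned a chord of the circle (given
by its two distinct end points, listed in an arbitrary order), and two different vertices are
adjacent if and only if their chords intersect. -/
structure ChordRep {V : Type*} (G : SimpleGraph V) where
  endA : V → Circle
  endB : V → Circle
  endA_ne_endB : ∀ v, endA v ≠ endB v
  adj_iff : ∀ u v, G.Adj u v ↔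
    u ≠ v ∧ (chord (endA u) (endB u) ∩ chord (endA v) (endB v)).Nonempty

variable {V : Type*} {G : SimpleGraph V}

/-- The chord of the vertex `v`. -/
def ChordRep.chordOf (R : ChordRep G) (v : V) : Set ℂ := chord (R.endA v) (R.endB v)

/-- The end point `false` of a vertex is `endA`, the end point `true` is `endB`. -/
def ChordRep.point (R : ChordRep G) (x : V × Bool) : Circle :=
  if x.2 then R.endB x.1 else R.endA x.1

/-- `side p q x` is positive if `x` lies strictly to the left of the line from `p` to `q`, negative
if it lies strictly to the right of it, and zero if it lies on the line. -/
def side (p q x : Circle) : ℝ :=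
  ((q : ℂ).re - (p : ℂ).re) * ((x : ℂ).im - (p : ℂ).im) -
    ((q : ℂ).im - (p : ℂ).im) * ((x : ℂ).re - (p : ℂ).re)

/-! ### Shortest paths and their reconfiguration -/

/-- An `s`-`t` walk is a shortest path if its length is the distance of `s` and `t`. -/
def IsShortest {s t : V} (P : G.Walk s t) : Prop := P.length = G.dist s t

/-- `W 0, …, W k` is a reconfiguration sequence with `k` steps from `P` to `Q`: all its members are
`s`-`t` shortest paths, and consecutive ones differ in exactly one vertex. -/
def IsReconfSeq {s t : V} (k : ℕ) (W : ℕ → G.Walk s t) (P Q : G.Walk s t) : Prop :=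
  W 0 = P ∧ W k = Q ∧ (∀ j ≤ k, IsShortest (W j)) ∧
    ∀ j < k, ∃! i : ℕ, (W j).getVert i ≠ (W (j + 1)).getVert i

/-- `P` and `Q` are reconfigurable. -/
def Reconfigurable {s t : V} (P Q : G.Walk s t) : Prop :=
  ∃ (k : ℕ) (W : ℕ → G.Walk s t), IsReconfSeq k W P Q

/-! ### Orientation of the chords and labels -/

/-- On the chord of `v`, travelling from `endA v` to `endB v`, one meets the intersection point with
the chord of `u` before the intersection point with the chord of `w`. -/
def ChordRep.RunsFromA (R : ChordRep G) (u v w : V) : Prop :=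
  ∃ x ∈ R.chordOf u ∩ R.chordOf v, ∃ y ∈ R.chordOf w ∩ R.chordOf v,
    dist (R.endA v : ℂ) x < dist (R.endA v : ℂ) y

open Classical in
/-- The first end point of the chord of the `i`-th vertex of `P` (`0 < i < P.length`), when this
chord is oriented from its intersection point with the chord of the previous vertex to its
intersection point with the chord of the next vertex. -/
def ChordRep.firstEnd (R : ChordRep G) {s t : V} (P : G.Walk s t) (i : ℕ) : Circle :=
  if R.RunsFromA (P.getVert (i - 1)) (P.getVert i) (P.getVert (i + 1))
  then R.endA (P.getVert i) else R.endB (P.getVert i)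

open Classical in
/-- The second end point of the chord of the `i`-th vertex of `P`, oriented in the same way. -/
def ChordRep.secondEnd (R : ChordRep G) {s t : V} (P : G.Walk s t) (i : ℕ) : Circle :=
  if R.RunsFromA (P.getVert (i - 1)) (P.getVert i) (P.getVert (i + 1))
  then R.endB (P.getVert i) else R.endA (P.getVert i)

/-- An equator is an additional chord that intersects the chords of `s` and `t`. -/
def ChordRep.IsEquator (R : ChordRep G) (s t : V) (e₁ e₂ : Circle) : Prop :=
  e₁ ≠ e₂ ∧ (chord e₁ e₂ ∩ R.chordOf s).Nonempty ∧ (chord e₁ e₂ ∩ R.chordOf t).Nonempty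

/-- The chord of `u` passes through `x` or separates `x` from the (disjoint) chord of `w`. -/
def ChordRep.Behind (R : ChordRep G) (u w : V) (x : Circle) : Prop :=
  side (R.endA u) (R.endB u) x * side (R.endA u) (R.endB u) (R.endA w) ≤ 0

/-- The letters for end points: behind `s`, behind `t`, and, between `s` and `t`, above (`top`) or
below (`bottom`) the equator. -/
inductive Letter
  | source
  | target
  | top
  | bottom

open Classical in
/-- The letter of a point of the circle with respect to `s`, `t` and the equator `e₁ e₂`. -/
def ChordRep.letter (R : ChordRep G) (s t : V) (e₁ e₂ x : Circle) : Letter :=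
  if R.Behind s t x then Letter.source
  else if R.Behind t s x then Letter.target
  else if 0 < side e₁ e₂ x then Letter.top
  else Letter.bottom

/-- The label of an `s`-`t` shortest path: the string of the labels (letter of the first end point,
letter of the second end point) of its inner vertices, in the order from `s` to `t`. -/
def ChordRep.label (R : ChordRep G) {s t : V} (e₁ e₂ : Circle) (P : G.Walk s t) :
    List (Letter × Letter) :=
  (List.range (P.length - 1)).map fun j =>
    (R.letter s t e₁ e₂ (R.firstEnd P (j + 1)), R.letter s t e₁ e₂ (R.secondEnd P (j + 1)))

end

/-! ### A random access machine with unit costs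

Programs work on registers and on arrays (random access memory), all with natural number entries.
The only arithmetic is the change of a register by one, so that a run of `T` steps increases the
largest number in store by at most `T` (or to a constant of the program). -/

/-- The contents of the registers and of the arrays. -/
structure State where
  reg : ℕ → ℕ
  arr : ℕ → ℕ → ℕ

/-- Assignment of the value `a` to the register `x`. -/
def State.setReg (σ : State) (x a : ℕ) : State :=
  { σ with reg := Function.update σ.reg x a }

/-- Assignment of the value `a` to the entry `i` of the array `A`. -/
def State.setArr (σ : State) (A i a : ℕ) : State :=
  { σ with arr := Function.update σ.arr A (Function.update (σ.arr A) i a) }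

/-- Programs. Registers `x`, `y` and arrays `A` are named by fixed numbers; the index of an array
access is the content of a register. -/
inductive Cmd
  | skip
  | const (x c : ℕ)
  | copy (x y : ℕ)
  | succ (x : ℕ)
  | pred (x : ℕ)
  | load (x A i : ℕ)
  | store (A i x : ℕ)
  | seq (c₁ c₂ : Cmd)
  | ifLt (x y : ℕ) (c₁ c₂ : Cmd)
  | whileLt (x y : ℕ) (c : Cmd)

/-- `Runs c σ σ' T`: started in `σ`, the program `c` halts in `σ'` after exactly `T` steps. Every
elementary command and every evaluation of a test is one step. -/
inductive Runs : Cmd → State → State → ℕ → Prop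
  | skip (σ : State) : Runs Cmd.skip σ σ 1
  | const (x c : ℕ) (σ : State) : Runs (Cmd.const x c) σ (σ.setReg x c) 1
  | copy (x y : ℕ) (σ : State) : Runs (Cmd.copy x y) σ (σ.setReg x (σ.reg y)) 1
  | succ (x : ℕ) (σ : State) : Runs (Cmd.succ x) σ (σ.setReg x (σ.reg x + 1)) 1
  | pred (x : ℕ) (σ : State) : Runs (Cmd.pred x) σ (σ.setReg x (σ.reg x - 1)) 1
  | load (x A i : ℕ) (σ : State) :
      Runs (Cmd.load x A i) σ (σ.setReg x (σ.arr A (σ.reg i))) 1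
  | store (A i x : ℕ) (σ : State) :
      Runs (Cmd.store A i x) σ (σ.setArr A (σ.reg i) (σ.reg x)) 1
  | seq {c₁ c₂ : Cmd} {σ σ₁ σ₂ : State} {T₁ T₂ : ℕ} :
      Runs c₁ σ σ₁ T₁ → Runs c₂ σ₁ σ₂ T₂ → Runs (Cmd.seq c₁ c₂) σ σ₂ (T₁ + T₂)
  | ifLt_true {x y : ℕ} {c₁ c₂ : Cmd} {σ σ₁ : State} {T : ℕ} :
      σ.reg x < σ.reg y → Runs c₁ σ σ₁ T → Runs (Cmd.ifLt x y c₁ c₂) σ σ₁ (1 + T)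
  | ifLt_false {x y : ℕ} {c₁ c₂ : Cmd} {σ σ₁ : State} {T : ℕ} :
      ¬ σ.reg x < σ.reg y → Runs c₂ σ σ₁ T → Runs (Cmd.ifLt x y c₁ c₂) σ σ₁ (1 + T)
  | whileLt_true {x y : ℕ} {c : Cmd} {σ σ₁ σ₂ : State} {T₁ T₂ : ℕ} :
      σ.reg x < σ.reg y → Runs c σ σ₁ T₁ → Runs (Cmd.whileLt x y c) σ₁ σ₂ T₂ →
      Runs (Cmd.whileLt x y c) σ σ₂ (1 + T₁ + T₂)
  | whileLt_false {x y : ℕ} {c : Cmd} {σ : State} :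
      ¬ σ.reg x < σ.reg y → Runs (Cmd.whileLt x y c) σ σ 1

/-! ### Input and output of the algorithm -/

section

variable {V : Type*} [Fintype V] {G : SimpleGraph V}

/-- `num` numbers the `2n` chord end points by integers below `2n` in the counterclockwise order in
which they appear on the circle (from the point `-1` on); end points that coincide get the same
number. -/
def ChordRep.IsNumbering (R : ChordRep G) (num : V × Bool → ℕ) : Prop :=
  (∀ x, num x < 2 * Fintype.card V) ∧
    ∀ x y, num x < num y ↔ Complex.arg (R.point x : ℂ) < Complex.arg (R.point y : ℂ)

/-- The initial state for a circle representation and two shortest paths: `n` and the length of the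
paths in the registers `0` and `1`, the positions of the two end points of the chords in the arrays
`0` and `1` (indexed by the vertices, which are named `0, …, n - 1` by `idx`), and the vertices of
the two paths in the arrays `2` and `3`. Everything else is zero. -/
def inputState (idx : V ≃ Fin (Fintype.card V)) (num : V × Bool → ℕ) {s t : V}
    (P Q : G.Walk s t) : State where
  reg r := if r = 0 then Fintype.card V else if r = 1 then P.length else 0
  arr A j :=
    if A = 0 then (if h : j < Fintype.card V then num (idx.symm ⟨j, h⟩, false) else 0)
    else if A = 1 then (if h : j < Fintype.card V then num (idx.symm ⟨j, h⟩, true) else 0)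
    else if A = 2 then (if j ≤ P.length then (idx (P.getVert j) : ℕ) else 0)
    else if A = 3 then (if j ≤ Q.length then (idx (Q.getVert j) : ℕ) else 0)
    else 0

/-- The final state `σ` describes a reconfiguration sequence from `P` to `Q`: register `1` holds the
number of steps, and for each step the arrays `4` and `5` hold the position in which the path is
changed and the new vertex at this position. -/
def OutputsReconfSeq (idx : V ≃ Fin (Fintype.card V)) {s t : V} (P Q : G.Walk s t)
    (σ : State) : Prop :=
  ∃ W : ℕ → G.Walk s t, IsReconfSeq (σ.reg 1) W P Q ∧
    ∀ j < σ.reg 1,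
      (W j).getVert (σ.arr 4 j) ≠ (W (j + 1)).getVert (σ.arr 4 j) ∧
      σ.arr 5 j = (idx ((W (j + 1)).getVert (σ.arr 4 j)) : ℕ)

end

end CircleSPR

open CircleSPR

namespace CircleSPR

/-! ### Sides of a chord -/

/-! Two chords are disjoint exactly when the end points of one lie strictly on one side of the other
(`chord_inter_iff`). Hence a chain of successively intersecting chords that avoids a given chord
stays on one side of it (`sameSide_chain`), and two chains that avoid each other have no interleaved
end points (`sameSide_of_walks`). Along shortest paths, chords whose positions differ by at least
two are disjoint, even when taken from different paths, so such chains are plentiful. Orienting the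
chord of an inner vertex puts its first end on the side of the previous vertex, seen from the next
chord, and its second end on the side of the next vertex, seen from the previous chord
(`tailSide_spec`). A crossing chord cannot have both ends on one side, which makes the orientation
independent of the path.

The chords of `s` and `t` leave two arcs of the circle between them, and an equator merely names
these arcs top and bottom. The geometric core is `IsFrame.consecutive`: the second end of one inner
chord and the first end of the next lie on the same arc, the latter being not farther from `s` along
this arc. Thus the letters of an inner vertex are already written on its two neighbours, apart from
the fixed letters at the ends of the path. A change of one vertex therefore preserves the label.

Conversely, let the labels agree. At each position the second ends of the two chords lie on a common
arc. If the first end of the next chord of the other path is not beyond the second end of the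
present one, the two chords meet, because otherwise two disjoint chains would have interleaved ends
(`adj_of_le`). Comparing both paths gives the condition `Exchangeable`: for consecutive inner
positions, `P i` is adjacent to `Q (i + 1)` or `Q i` to `P (i + 1)`. This condition does not mention
the equator.

Exchangeability suffices for a greedy construction from left to right. A block `l, …, r` is extended
while `Q r` is not adjacent to `P (r + 1)`, so that `P r` is adjacent to `Q (r + 1)`. Once the block
closes, its positions are switched from `P` to `Q` in decreasing order; the adjacencies inside the
block and at its two borders keep every intermediate sequence a shortest path. Every position is
switched at most once, which gives linear length. The program performs this construction, and it
rejects when neither adjacency holds. Its correctness, proved with the invariant `Stage`, also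
supplies the existence of the short sequences. -/

/-- The affine function of the plane that restricts to `side p q` on the circle. -/
def planeSide (p q : Circle) (z : ℂ) : ℝ :=
  ((q : ℂ).re - (p : ℂ).re) * (z.im - (p : ℂ).im) -
    ((q : ℂ).im - (p : ℂ).im) * (z.re - (p : ℂ).re)

theorem planeSide_coe (p q x : Circle) : planeSide p q (x : ℂ) = side p q x := rfl

theorem planeSide_combo (p q : Circle) (z w : ℂ) (a b : ℝ) (h : a + b = 1) :
    planeSide p q (a • z + b • w) = a * planeSide p q z + b * planeSide p q w := by
  obtain rfl : a = 1 - b := by linarith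
  simp [planeSide]
  ring

theorem Circle.re_sq_add_im_sq (x : Circle) : (x : ℂ).re ^ 2 + (x : ℂ).im ^ 2 = 1 := by
  have h := Circle.normSq_coe x
  rw [Complex.normSq_apply] at h
  linarith

theorem planeSide_eq_zero_of_mem {p q : Circle} {z : ℂ} (h : z ∈ chord p q) :
    planeSide p q z = 0 := by
  obtain ⟨a, b, -, -, hab, rfl⟩ := h
  rw [planeSide_combo _ _ _ _ _ _ hab]
  simp [planeSide]
  right
  ring

/-- A convex combination of points of the circle lies in the closed disc. -/
theorem re_sq_add_im_sq_le_of_mem {p q : Circle} {z : ℂ} (h : z ∈ chord p q) :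
    z.re ^ 2 + z.im ^ 2 ≤ 1 := by
  obtain ⟨a, b, ha, hb, hab, rfl⟩ := h
  have hp := Circle.re_sq_add_im_sq p
  have hq := Circle.re_sq_add_im_sq q
  obtain rfl : a = 1 - b := by linarith
  simp only [Complex.real_smul, Complex.add_re, Complex.mul_re, Complex.ofReal_re,
    Complex.ofReal_im, zero_mul, sub_zero, Complex.add_im, Complex.mul_im, add_zero]
  nlinarith [mul_nonneg ha hb, sq_nonneg ((p : ℂ).re - (q : ℂ).re),
    sq_nonneg ((p : ℂ).im - (q : ℂ).im),
    mul_nonneg (mul_nonneg ha hb) (sq_nonneg ((p : ℂ).re - (q : ℂ).re)),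
    mul_nonneg (mul_nonneg ha hb) (sq_nonneg ((p : ℂ).im - (q : ℂ).im))]

/-- A point of the closed disc on the line through `p` and `q` lies on the chord. -/
theorem mem_chord_of_planeSide_eq_zero {p q : Circle} (hpq : p ≠ q) {z : ℂ}
    (hz : z.re ^ 2 + z.im ^ 2 ≤ 1) (h : planeSide p q z = 0) : z ∈ chord p q := by
  have hp := Circle.re_sq_add_im_sq p
  have hq := Circle.re_sq_add_im_sq q
  set p1 := (p : ℂ).re with hp1
  set p2 := (p : ℂ).im with hp2
  set q1 := (q : ℂ).re with hq1
  set q2 := (q : ℂ).im with hq2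
  have hD : 0 < (q1 - p1) ^ 2 + (q2 - p2) ^ 2 := by
    by_contra hc
    apply hpq
    have h1 : q1 - p1 = 0 := by nlinarith [sq_nonneg (q1 - p1), sq_nonneg (q2 - p2)]
    have h2 : q2 - p2 = 0 := by nlinarith [sq_nonneg (q1 - p1), sq_nonneg (q2 - p2)]
    apply Circle.ext
    apply Complex.ext <;> linarith
  set D := (q1 - p1) ^ 2 + (q2 - p2) ^ 2 with hDdef
  have h' : (q1 - p1) * (z.im - p2) - (q2 - p2) * (z.re - p1) = 0 := h
  set τ := ((q1 - p1) * (z.re - p1) + (q2 - p2) * (z.im - p2)) / D with hτ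
  have hτD : τ * D = (q1 - p1) * (z.re - p1) + (q2 - p2) * (z.im - p2) := by
    rw [hτ]; field_simp
  have e1 : z.re = p1 + τ * (q1 - p1) := by
    have : D * (z.re - (p1 + τ * (q1 - p1))) = 0 := by
      linear_combination (-(q1 - p1)) * hτD - (q2 - p2) * h' + (z.re - p1) * hDdef
    rcases mul_eq_zero.1 this with h0 | h0 <;> linarith
  have e2 : z.im = p2 + τ * (q2 - p2) := by
    have : D * (z.im - (p2 + τ * (q2 - p2))) = 0 := by
      linear_combination (-(q2 - p2)) * hτD + (q1 - p1) * h' + (z.im - p2) * hDdef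
    rcases mul_eq_zero.1 this with h0 | h0 <;> linarith
  -- Since `p` and `q` have norm one, the squared norm at parameter `τ` is `1 + D * (τ * (τ - 1))`;
  -- lying in the disc thus forces `τ` into the unit interval.
  have hle : D * (τ * (τ - 1)) ≤ 0 := by
    rw [e1, e2] at hz
    have : (p1 + τ * (q1 - p1)) ^ 2 + (p2 + τ * (q2 - p2)) ^ 2
        = 1 + D * (τ * (τ - 1)) := by
      linear_combination (1 - τ) * hp + τ * hq - (τ * (τ - 1)) * hDdef
    linarith
  have hle' : τ * (τ - 1) ≤ 0 := by
    by_contra hc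
    push Not at hc
    linarith [mul_pos hD hc]
  have h0 : 0 ≤ τ := by nlinarith
  have h1 : τ ≤ 1 := by nlinarith
  refine ⟨1 - τ, τ, by linarith, h0, by ring, ?_⟩
  apply Complex.ext
  · simp only [Complex.real_smul, Complex.add_re, Complex.mul_re, Complex.ofReal_re,
      Complex.ofReal_im, zero_mul, sub_zero]
    linarith
  · simp only [Complex.real_smul, Complex.add_im, Complex.mul_im, Complex.ofReal_re,
      Complex.ofReal_im, zero_mul, add_zero]
    linarith

/-- Two points of the circle lie strictly on the same side of the line through `p` and `q`. -/
def SameSide (p q x y : Circle) : Prop := 0 < side p q x * side p q y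

theorem SameSide.symm {p q x y : Circle} (h : SameSide p q x y) : SameSide p q y x := by
  unfold SameSide at *; linarith

theorem SameSide.trans {p q x y z : Circle} (h : SameSide p q x y) (h' : SameSide p q y z) :
    SameSide p q x z := by
  unfold SameSide at *
  have := mul_pos h h'
  have h0 : side p q y ≠ 0 := by rintro h0; simp [h0] at h
  have : 0 < (side p q x * side p q z) * (side p q y) ^ 2 := by nlinarith
  exact pos_of_mul_pos_left this (sq_nonneg _)

/-- A chord meets the chord `x y` if and only if it does not have `x` and `y` on the same side. -/
theorem chord_inter_iff {p q : Circle} (hpq : p ≠ q) (x y : Circle) :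
    (chord p q ∩ chord x y).Nonempty ↔ ¬ SameSide p q x y := by
  constructor
  · rintro ⟨z, hz, hz'⟩ h
    have h0 := planeSide_eq_zero_of_mem hz
    obtain ⟨a, b, ha, hb, hab, rfl⟩ := hz'
    rw [planeSide_combo _ _ _ _ _ _ hab, planeSide_coe, planeSide_coe] at h0
    unfold SameSide at h
    rcases mul_pos_iff.1 h with ⟨h1, h2⟩ | ⟨h1, h2⟩ <;>
    rcases ha.lt_or_eq with h3 | h3 <;> nlinarith [mul_pos_iff.1 h]
  · intro h
    unfold SameSide at h
    push Not at h
    suffices ∃ z ∈ chord x y, planeSide p q z = 0 by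
      obtain ⟨z, hz, h0⟩ := this
      exact ⟨z, mem_chord_of_planeSide_eq_zero hpq (re_sq_add_im_sq_le_of_mem hz) h0, hz⟩
    by_cases h0 : side p q x = side p q y
    · refine ⟨x, left_mem_segment ℝ _ _, ?_⟩
      rw [planeSide_coe]
      rw [← h0] at h
      nlinarith
    · have hne : side p q x - side p q y ≠ 0 := sub_ne_zero.2 h0
      have key : ∀ α β : ℝ, α * β ≤ 0 → α ≠ β → 0 ≤ α / (α - β) := by
        intro α β hαβ hne
        rcases lt_or_gt_of_ne hne with h1 | h1
        · exact div_nonneg_of_nonpos (by nlinarith) (by linarith)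
        · exact div_nonneg (by nlinarith) (by linarith)
      -- These weights give the zero of the affine function `planeSide p q` on the segment; opposite
      -- signs at the ends make both of them nonnegative.
      refine ⟨_, ⟨-side p q y / (side p q x - side p q y), side p q x / (side p q x - side p q y),
        ?_, key _ _ h h0, ?_, rfl⟩, ?_⟩
      · have := key (side p q y) (side p q x) (by linarith) (Ne.symm h0)
        rwa [← neg_div_neg_eq, neg_sub] at this
      · field_simp
        ring
      · rw [planeSide_combo _ _ _ _ _ _ (by field_simp; ring), planeSide_coe, planeSide_coe]
        field_simp
        ring

/-- Both statements express disjointness of the same two chords. Nondegeneracy of both is needed, as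
either may play the role of the separating line. -/
theorem sameSide_comm_iff {p q x y : Circle} (hpq : p ≠ q) (hxy : x ≠ y) :
    SameSide p q x y ↔ SameSide x y p q := by
  rw [← not_iff_not, ← chord_inter_iff hpq, ← chord_inter_iff hxy, Set.inter_comm]

/-- Two chords that meet, each with its end points on one side of `p q`, are on the same side. -/
theorem SameSide.of_inter {p q x y z w : Circle} (hxy : SameSide p q x y)
    (hzw : SameSide p q z w) (h : (chord x y ∩ chord z w).Nonempty) : SameSide p q x z := by
  obtain ⟨m, ⟨a, b, ha, hb, hab, rfl⟩, a', b', ha', hb', hab', he⟩ := h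
  have h1 := congrArg (planeSide p q) he
  rw [planeSide_combo _ _ _ _ _ _ hab, planeSide_combo _ _ _ _ _ _ hab', planeSide_coe,
    planeSide_coe, planeSide_coe, planeSide_coe] at h1
  have aux : ∀ a b α β : ℝ, 0 ≤ a → 0 ≤ b → a + b = 1 → 0 < α → 0 < β → 0 < a * α + b * β := by
    intro a b α β ha hb hab hα hβ
    rcases ha.lt_or_eq with h | h
    · nlinarith [mul_pos h hα, mul_nonneg hb hβ.le]
    · subst h
      nlinarith
  unfold SameSide at *
  rcases mul_pos_iff.1 hxy with ⟨h2, h3⟩ | ⟨h2, h3⟩ <;>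
  rcases mul_pos_iff.1 hzw with ⟨h4, h5⟩ | ⟨h4, h5⟩
  · positivity
  · have := aux _ _ _ _ ha hb hab h2 h3
    have := aux _ _ _ _ ha' hb' hab' (neg_pos.2 h4) (neg_pos.2 h5)
    linarith
  · have := aux _ _ _ _ ha hb hab (neg_pos.2 h2) (neg_pos.2 h3)
    have := aux _ _ _ _ ha' hb' hab' h4 h5
    linarith
  · exact mul_pos_of_neg_of_neg h2 h4

/-! ### Sides and the cyclic order of positions -/

/-- `a`, `b`, `c` are in strict cyclic order. -/
def Cyc (a b c : ℝ) : Prop := (a < b ∧ b < c) ∨ (b < c ∧ c < a) ∨ (c < a ∧ a < b)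

/-- The factorisation turns the sign of the determinant into the signs of three angle differences.
-/
theorem side_exp (α β γ : ℝ) : side (Circle.exp α) (Circle.exp β) (Circle.exp γ) =
    4 * Real.sin ((β - α) / 2) * Real.sin ((γ - β) / 2) * Real.sin ((γ - α) / 2) := by
  have h1 : side (Circle.exp α) (Circle.exp β) (Circle.exp γ) =
      Real.sin (2 * ((γ - β) / 2)) + Real.sin (2 * ((β - α) / 2)) - Real.sin (2 * ((γ - α) / 2)) := by
    have e : ∀ x : ℝ, 2 * (x / 2) = x := fun x => by ring
    rw [e, e, e, Real.sin_sub, Real.sin_sub, Real.sin_sub]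
    simp only [side, Circle.coe_exp, Complex.exp_ofReal_mul_I_re, Complex.exp_ofReal_mul_I_im]
    ring
  have h2 : (γ - α) / 2 = (β - α) / 2 + (γ - β) / 2 := by ring
  rw [h1, h2]
  set U := (β - α) / 2
  set W := (γ - β) / 2
  rw [mul_add, Real.sin_add (2 * U), Real.sin_add U, Real.sin_two_mul, Real.sin_two_mul,
    Real.cos_two_mul' U, Real.cos_two_mul' W]
  have hU := Real.sin_sq_add_cos_sq U
  have hW := Real.sin_sq_add_cos_sq W
  linear_combination (-2 * Real.sin W * Real.cos W) * hU - (2 * Real.sin U * Real.cos U) * hW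

theorem side_swap (p q x : Circle) : side q p x = - side p q x := by
  unfold side; ring

theorem side_left (p q : Circle) : side p q p = 0 := by unfold side; ring
theorem side_right (p q : Circle) : side p q q = 0 := by unfold side; ring

/-- The real numbers `pos x` list the points of the circle in counterclockwise order, from some
point on. -/
structure IsPosition (pos : Circle → ℝ) : Prop where
  injective : Function.Injective pos
  side_pos_iff : ∀ p q x, 0 < side p q x ↔ Cyc (pos p) (pos q) (pos x)

/-- All half differences of positions lie strictly between `-π` and `π`, where the sine has the sign
of its argument. By `side_exp`, the sign of `side` then depends only on the order of the three
positions. -/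
theorem isPosition_of_exp {pos : Circle → ℝ} {θ : ℝ} (h : ∀ x, Circle.exp (θ + pos x) = x)
    (h3 : ∀ x y, pos x - pos y < 2 * Real.pi) : IsPosition pos := by
  have hs : ∀ x y, (0 < Real.sin ((pos y - pos x) / 2) ↔ pos x < pos y) := by
    intro x y
    constructor
    · intro h0
      by_contra hc
      push Not at hc
      exact absurd h0 (not_lt.2 (Real.sin_nonpos_of_nonpos_of_neg_pi_le (by linarith)
        (by linarith [h3 x y])))
    · intro h0
      exact Real.sin_pos_of_pos_of_lt_pi (by linarith) (by linarith [h3 y x])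
  have hs' : ∀ x y, (Real.sin ((pos y - pos x) / 2) < 0 ↔ pos y < pos x) := by
    intro x y
    rw [← hs, ← neg_pos, ← Real.sin_neg]
    ring_nf
  refine ⟨fun x y hxy => by rw [← h x, ← h y, hxy], fun p q x => ?_⟩
  have e := side_exp (θ + pos p) (θ + pos q) (θ + pos x)
  rw [h, h, h] at e
  have e1 : ∀ a b : ℝ, θ + a - (θ + b) = a - b := fun a b => by ring
  rw [e1, e1, e1] at e
  have k : ∀ a b c : ℝ, 0 < 4 * a * b * c ↔
      (0 < a ∧ 0 < b ∧ 0 < c) ∨ (0 < a ∧ b < 0 ∧ c < 0) ∨ (a < 0 ∧ 0 < b ∧ c < 0) ∨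
        (a < 0 ∧ b < 0 ∧ 0 < c) := by
    intro a b c
    rw [mul_assoc, mul_assoc, mul_pos_iff, mul_pos_iff, mul_neg_iff]
    simp only [mul_pos_iff, mul_neg_iff]
    have : (0 : ℝ) < 4 := by norm_num
    have : ¬ (4 : ℝ) < 0 := by norm_num
    tauto
  rw [e, k]
  simp only [hs, hs', Cyc]
  constructor
  · rintro (h | h | h | h) <;> grind
  · rintro (h | h | h) <;> grind

theorem isPosition_arg : IsPosition fun x => Complex.arg (x : ℂ) := by
  refine isPosition_of_exp (θ := 0) ?_ ?_
  · intro x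
    rw [zero_add, Circle.exp_arg]
  · intro x y
    linarith [Complex.arg_le_pi (x : ℂ), Complex.neg_pi_lt_arg (y : ℂ)]

/-- The positions may be counted from any given point on. -/
theorem exists_isPosition_min (z : Circle) :
    ∃ pos : Circle → ℝ, IsPosition pos ∧ ∀ x, pos z ≤ pos x := by
  refine ⟨fun x => -Complex.arg ((z / x * Circle.exp Real.pi : Circle) : ℂ), ?_, ?_⟩
  -- The principal argument attains its maximum `π` at `-1`. The quotient is turned so that `z` is
  -- sent there, and the sign is changed to make `z` the minimum and to keep the positions
  -- counterclockwise.
  · refine isPosition_of_exp (θ := Complex.arg (z : ℂ) + Real.pi) ?_ ?_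
    · intro x
      rw [Circle.exp_add, Circle.exp_neg, Circle.exp_arg, Circle.exp_add, Circle.exp_arg]
      group
      simp
    · intro x y
      linarith [Complex.neg_pi_lt_arg ((z / x * Circle.exp Real.pi : Circle) : ℂ),
        Complex.arg_le_pi ((z / y * Circle.exp Real.pi : Circle) : ℂ)]
  · intro x
    have : ((z / z * Circle.exp Real.pi : Circle) : ℂ) = -1 := by
      simp
    simp only [this, Complex.arg_neg_one]
    linarith [Complex.arg_le_pi ((z / x * Circle.exp Real.pi : Circle) : ℂ)]

theorem IsPosition.side_neg_iff {pos : Circle → ℝ} (h : IsPosition pos) (p q x : Circle) :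
    side p q x < 0 ↔ Cyc (pos q) (pos p) (pos x) := by
  rw [← h.side_pos_iff, side_swap]
  constructor <;> intro h <;> linarith

theorem IsPosition.sameSide_iff {pos : Circle → ℝ} (h : IsPosition pos) (p q x y : Circle) :
    SameSide p q x y ↔ (Cyc (pos p) (pos q) (pos x) ∧ Cyc (pos p) (pos q) (pos y)) ∨
      (Cyc (pos q) (pos p) (pos x) ∧ Cyc (pos q) (pos p) (pos y)) := by
  unfold SameSide
  rw [mul_pos_iff, h.side_pos_iff, h.side_pos_iff, h.side_neg_iff, h.side_neg_iff]

end CircleSPR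

namespace CircleSPR

variable {V : Type*} {G : SimpleGraph V}

/-! ### Levels of the vertices of shortest paths -/

/-- Following `P` up to `i`, then the edge, then the rest of `Q` gives a walk from `s` to `t`, which
cannot be shorter than `Q`. -/
theorem IsShortest.le_of_adj {s t : V} {P Q : G.Walk s t} (hQ : IsShortest Q) {i j : ℕ}
    (hj : j ≤ Q.length)
    (h : G.Adj (P.getVert i) (Q.getVert j)) : j ≤ i + 1 := by
  have := SimpleGraph.dist_le ((P.take i).append (SimpleGraph.Walk.cons h (Q.drop j)))
  simp only [SimpleGraph.Walk.length_append, SimpleGraph.Walk.length_cons,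
    SimpleGraph.Walk.take_length, SimpleGraph.Walk.drop_length] at this
  unfold IsShortest at hQ
  omega

theorem IsShortest.le_of_eq {s t : V} {P Q : G.Walk s t} (hQ : IsShortest Q) {i j : ℕ}
    (hj : j ≤ Q.length)
    (h : P.getVert i = Q.getVert j) : j ≤ i := by
  have := SimpleGraph.dist_le ((P.take i).append ((Q.drop j).copy h.symm rfl))
  simp only [SimpleGraph.Walk.length_append, SimpleGraph.Walk.length_copy,
    SimpleGraph.Walk.take_length, SimpleGraph.Walk.drop_length] at this
  unfold IsShortest at hQ
  omega

theorem IsShortest.index_eq {s t : V} {P Q : G.Walk s t} (hP : IsShortest P) (hQ : IsShortest Q)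
    {i j : ℕ} (hi : i ≤ P.length) (hj : j ≤ Q.length) (h : P.getVert i = Q.getVert j) : i = j :=
  le_antisymm (hP.le_of_eq hi h.symm) (hQ.le_of_eq hj h)

theorem IsShortest.length_eq {s t : V} {P Q : G.Walk s t} (hP : IsShortest P)
    (hQ : IsShortest Q) : P.length = Q.length := by
  unfold IsShortest at hP hQ; omega

/-! ### Chords on one side of a chord -/

namespace ChordRep

variable (R : ChordRep G)

/-- The vertices `u` and `v` are different and their chords are disjoint. -/
def Apart (G : SimpleGraph V) (u v : V) : Prop := u ≠ v ∧ ¬ G.Adj u v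

theorem Apart.symm {u v : V} (h : Apart G u v) : Apart G v u :=
  ⟨h.1.symm, fun h' => h.2 h'.symm⟩

theorem point_ne (v : V) {b c : Bool} (h : b ≠ c) : R.point (v, b) ≠ R.point (v, c) := by
  have := R.endA_ne_endB v
  cases b <;> cases c <;> simp_all [point, this.symm]

theorem not_sameSide_of_adj {u v : V} (h : G.Adj u v) {b c : Bool} (hbc : b ≠ c) :
    ¬ SameSide (R.endA u) (R.endB u) (R.point (v, b)) (R.point (v, c)) := by
  have h' := (chord_inter_iff (R.endA_ne_endB u) _ _).1 ((R.adj_iff u v).1 h).2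
  have h'' : ¬ SameSide (R.endA u) (R.endB u) (R.endB v) (R.endA v) := fun h => h' h.symm
  cases b <;> cases c <;> simp_all [point]

theorem Apart.sameSide {R : ChordRep G} {u v : V} (h : Apart G u v) (b c : Bool) :
    SameSide (R.endA u) (R.endB u) (R.point (v, b)) (R.point (v, c)) := by
  have h1 : SameSide (R.endA u) (R.endB u) (R.endA v) (R.endB v) := by
    by_contra hc
    exact h.2 ((R.adj_iff u v).2 ⟨h.1, (chord_inter_iff (R.endA_ne_endB u) _ _).2 hc⟩)
  have h2 := h1.symm
  have h3 := h1.trans h2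
  have h4 := h2.trans h1
  cases b <;> cases c <;> simpa [point]

/-- Successively intersecting chords that do not meet the chord `p q` lie on one side of it. -/
theorem sameSide_chain {p q : Circle} {f : ℕ → V} {m n : ℕ}
    (hadj : ∀ k, m ≤ k → k < n → G.Adj (f k) (f (k + 1)))
    (hside : ∀ k, m ≤ k → k ≤ n → SameSide p q (R.endA (f k)) (R.endB (f k)))
    {i j : ℕ} (hi : m ≤ i) (hi' : i ≤ n) (hj : m ≤ j) (hj' : j ≤ n) (b c : Bool) :
    SameSide p q (R.point (f i, b)) (R.point (f j, c)) := by
  have key : ∀ k, m ≤ k → k ≤ n → ∀ b, SameSide p q (R.endA (f m)) (R.point (f k, b)) := by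
    intro k hk
    induction k, hk using Nat.le_induction with
    | base =>
      intro hm b
      have h := hside m le_rfl hm
      cases b
      · exact h.trans h.symm
      · exact h
    | succ k hk ih =>
      intro hk' b
      have h1 := ih (by omega) false
      have h := hside (k + 1) (by omega) hk'
      have h2 := SameSide.of_inter (hside k hk (by omega)) h
        ((R.adj_iff _ _).1 (hadj k hk (by omega))).2
      cases b
      · exact h1.trans h2
      · exact (h1.trans h2).trans h
  exact (key i hi hi' b).symm.trans (key j hj hj' c)

theorem sameSide_walk {s t : V} (P : G.Walk s t) {u : V} {m n : ℕ} (hn : n ≤ P.length)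
    (h : ∀ k, m ≤ k → k ≤ n → Apart G u (P.getVert k))
    {i j : ℕ} (hi : m ≤ i) (hi' : i ≤ n) (hj : m ≤ j) (hj' : j ≤ n) (b c : Bool) :
    SameSide (R.endA u) (R.endB u) (R.point (P.getVert i, b)) (R.point (P.getVert j, c)) :=
  R.sameSide_chain (f := P.getVert) (fun k _ hk => P.adj_getVert_succ (by omega))
    (fun k hk hk' => (h k hk hk').sameSide false true) hi hi' hj hj' b c

/-- Two sequences of successively intersecting chords that do not meet each other are not
interleaved. -/
theorem sameSide_of_walks {s t s' t' : V} (P : G.Walk s t) (Q : G.Walk s' t') {m m' n n' : ℕ}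
    (hn : n ≤ P.length) (hn' : n' ≤ Q.length)
    (h : ∀ k, m ≤ k → k ≤ n → ∀ l, m' ≤ l → l ≤ n' → Apart G (P.getVert k) (Q.getVert l))
    {i j : ℕ} (hi : m ≤ i) (hi' : i ≤ n) (hj : m ≤ j) (hj' : j ≤ n) {b c : Bool}
    {k l : ℕ} (hk : m' ≤ k) (hk' : k ≤ n') (hl : m' ≤ l) (hl' : l ≤ n') (e f : Bool)
    (hne : R.point (P.getVert i, b) ≠ R.point (P.getVert j, c)) :
    SameSide (R.point (P.getVert i, b)) (R.point (P.getVert j, c))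
      (R.point (Q.getVert k, e)) (R.point (Q.getVert l, f)) := by
  refine R.sameSide_chain (f := Q.getVert) (m := m') (n := n')
    (fun k _ hk => Q.adj_getVert_succ (by omega)) (fun r hr hr' => ?_) hk hk' hl hl' e f
  -- The two chosen end points of `P` span an auxiliary chord. No chord of `Q` meets it, since the
  -- chain `P` stays on one side of each chord of `Q`.
  rw [sameSide_comm_iff hne (R.endA_ne_endB _)]
  exact R.sameSide_walk P hn (fun a ha ha' => (h a ha ha' r hr hr').symm) hi hi' hj hj' b c

/-! ### The end points of an oriented chord -/

open Classical in
/-- The first end point of the chord of `v`, oriented from `u` to `w`. -/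
noncomputable def tailSide (u v w : V) : Bool := !decide (R.RunsFromA u v w)

theorem firstEnd_eq {s t : V} (P : G.Walk s t) (i : ℕ) : R.firstEnd P i =
    R.point (P.getVert i,
      R.tailSide (P.getVert (i - 1)) (P.getVert i) (P.getVert (i + 1))) := by
  unfold firstEnd tailSide point
  split_ifs <;> simp_all

theorem secondEnd_eq {s t : V} (P : G.Walk s t) (i : ℕ) : R.secondEnd P i =
    R.point (P.getVert i,
      !R.tailSide (P.getVert (i - 1)) (P.getVert i) (P.getVert (i + 1))) := by
  unfold secondEnd tailSide point
  split_ifs <;> simp_all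

end ChordRep

theorem dist_combo (p q : Circle) {a b : ℝ} (hab : a + b = 1) (hb : 0 ≤ b) :
    dist (p : ℂ) (a • (p : ℂ) + b • (q : ℂ)) = b * dist (p : ℂ) q := by
  obtain rfl : a = 1 - b := by linarith
  have : (p : ℂ) - ((1 - b) • (p : ℂ) + b • (q : ℂ)) = b • ((p : ℂ) - q) := by
    module
  rw [dist_eq_norm, this, norm_smul, Real.norm_of_nonneg hb, dist_eq_norm]

/-- Along the chord `p q`, oriented such that it meets a chord on one side of the line `x y` before
it meets the line `x y`, the first end point is on the side of that chord. -/
theorem sameSide_of_lt {x y z w p q : Circle} (hzw : SameSide x y z w) {a b a' b' : ℝ}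
    (hab : a + b = 1) (hab' : a' + b' = 1) (hb : 0 ≤ b) (hlt : b < b')
    (h1 : a • (p : ℂ) + b • (q : ℂ) ∈ chord z w) (h2 : a' • (p : ℂ) + b' • (q : ℂ) ∈ chord x y) :
    SameSide x y p z := by
  have h2' := planeSide_eq_zero_of_mem h2
  rw [planeSide_combo _ _ _ _ _ _ hab', planeSide_coe, planeSide_coe] at h2'
  obtain ⟨c, d, hc, hd, hcd, he⟩ := h1
  have h3 := congrArg (planeSide x y) he
  rw [planeSide_combo _ _ _ _ _ _ hab, planeSide_combo _ _ _ _ _ _ hcd, planeSide_coe,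
    planeSide_coe, planeSide_coe, planeSide_coe] at h3
  obtain rfl : a = 1 - b := by linarith
  obtain rfl : a' = 1 - b' := by linarith
  -- An affine function vanishing at `b'` has the same sign at `0` and at `b`, because `0 ≤ b < b'`.
  have h4 : b' * ((1 - b) * side x y p + b * side x y q) = (b' - b) * side x y p := by
    linear_combination b * h2'
  have hb' : 0 < b' := by linarith
  have hbb : 0 < b' - b := by linarith
  have aux : ∀ a b α β : ℝ, 0 ≤ a → 0 ≤ b → a + b = 1 → 0 < α → 0 < β → 0 < a * α + b * β := by
    intro a b α β ha hb hab hα hβ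
    rcases ha.lt_or_eq with h | h
    · nlinarith [mul_pos h hα, mul_nonneg hb hβ.le]
    · subst h
      nlinarith
  unfold SameSide at *
  rw [← h3] at h4
  rcases mul_pos_iff.1 hzw with ⟨h5, h6⟩ | ⟨h5, h6⟩
  · have := mul_pos hb' (aux _ _ _ _ hc hd hcd h5 h6)
    rw [h4] at this
    exact mul_pos (pos_of_mul_pos_right this hbb.le) h5
  · have := mul_pos hb' (aux _ _ _ _ hc hd hcd (neg_pos.2 h5) (neg_pos.2 h6))
    have h7 : 0 < (b' - b) * (-side x y p) := by linarith
    exact mul_pos_of_neg_of_neg (neg_pos.1 (pos_of_mul_pos_right h7 hbb.le)) h5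

namespace ChordRep

variable (R : ChordRep G)

/-- This replaces the metric definition of the orientation by sides. The chord of `v` meets the
disjoint chords of `u` and `w` in this order; before it reaches `w` it is on the side of `u`, and
read backwards, before it reaches `u` it is on the side of `w`. -/
theorem tailSide_spec {u v w : V} (huv : G.Adj u v) (hvw : G.Adj v w) (huw : Apart G u w) :
    (∀ b, SameSide (R.endA w) (R.endB w) (R.point (v, R.tailSide u v w)) (R.point (u, b))) ∧
    (∀ b, SameSide (R.endA u) (R.endB u) (R.point (v, !R.tailSide u v w)) (R.point (w, b))) := by
  have hu := huw.sameSide (R := R)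
  have hw := huw.symm.sameSide (R := R)
  have hd : 0 < dist (R.endA v : ℂ) (R.endB v) :=
    dist_pos.2 fun h => R.endA_ne_endB v (Circle.ext h)
  suffices SameSide (R.endA w) (R.endB w) (R.point (v, R.tailSide u v w)) (R.endA u) ∧
      SameSide (R.endA u) (R.endB u) (R.point (v, !R.tailSide u v w)) (R.endA w) from
    ⟨fun b => this.1.trans (hw false b), fun b => this.2.trans (hu false b)⟩
  by_cases h : R.RunsFromA u v w
  · obtain ⟨x, ⟨hxu, a, b, ha, hb, hab, rfl⟩, y, ⟨hyw, a', b', ha', hb', hab', rfl⟩, hlt⟩ := id h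
    rw [dist_combo _ _ hab hb, dist_combo _ _ hab' hb'] at hlt
    have hlt' : b < b' := lt_of_mul_lt_mul_right hlt hd.le
    have ht : R.tailSide u v w = false := by simp [tailSide, h]
    simp only [ht, Bool.not_false]
    refine ⟨sameSide_of_lt (hw false true) hab hab' hb hlt' hxu hyw, ?_⟩
    refine sameSide_of_lt (p := R.endB v) (q := R.endA v) (a := b') (b := a') (a' := b)
      (b' := a) (hu false true) (by linarith) (by linarith) ha' (by linarith) ?_ ?_
    · rwa [add_comm]
    · rwa [add_comm]
  · obtain ⟨x, hxu, a, b, ha, hb, hab, rfl⟩ := ((R.adj_iff _ _).1 huv).2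
    obtain ⟨y, ⟨a', b', ha', hb', hab', rfl⟩, hyw⟩ := ((R.adj_iff _ _).1 hvw).2
    have ht : R.tailSide u v w = true := by simp [tailSide, h]
    have hle : b' ≤ b := by
      by_contra hc
      push Not at hc
      refine h ⟨_, ⟨hxu, a, b, ha, hb, hab, rfl⟩, _, ⟨hyw, a', b', ha', hb', hab', rfl⟩, ?_⟩
      rw [dist_combo _ _ hab hb, dist_combo _ _ hab' hb']
      exact mul_lt_mul_of_pos_right hc hd
    -- Equal parameters would give a common point of the disjoint chords of `u` and `w`.
    have hne : b' ≠ b := by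
      rintro rfl
      obtain rfl : a = a' := by linarith
      exact huw.2 ((R.adj_iff _ _).2 ⟨huw.1, _, hxu, hyw⟩)
    have hlt : b' < b := lt_of_le_of_ne hle hne
    simp only [ht, Bool.not_true]
    refine ⟨?_, sameSide_of_lt (p := R.endA v) (q := R.endB v) (hu false true) hab' hab hb' hlt
      hyw hxu⟩
    refine sameSide_of_lt (p := R.endB v) (q := R.endA v) (a := b) (b := a) (a' := b')
      (b' := a') (hw false true) (by linarith) (by linarith) ha (by linarith) ?_ ?_
    · rwa [add_comm]
    · rwa [add_comm]

/-! ### Separation along shortest paths -/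

theorem apart_of_add_two_le {s t : V} {P Q : G.Walk s t} (hP : IsShortest P) (hQ : IsShortest Q)
    {i j : ℕ} (hij : i + 2 ≤ j) (hj : j ≤ Q.length) : Apart G (P.getVert i) (Q.getVert j) := by
  have := hP.length_eq hQ
  constructor
  · intro h
    have := hP.index_eq hQ (by omega) hj h
    omega
  · intro h
    have := hQ.le_of_adj hj h
    omega

/-- A chord does not separate chords that are further by at least two. -/
theorem sameSide_later {s t : V} {P Q Q' : G.Walk s t} (hP : IsShortest P) (hQ : IsShortest Q)
    (hQ' : IsShortest Q') {i j k : ℕ} (hj : i + 2 ≤ j) (hj' : j ≤ Q.length) (hk : i + 2 ≤ k)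
    (hk' : k ≤ Q'.length) (b c : Bool) :
    SameSide (R.endA (P.getVert i)) (R.endB (P.getVert i)) (R.point (Q.getVert j, b))
      (R.point (Q'.getVert k, c)) := by
  have h1 := R.sameSide_walk Q (u := P.getVert i) (m := i + 2) le_rfl
    (fun k hk hk' => apart_of_add_two_le hP hQ hk hk') hj hj' (hj.trans hj') le_rfl b b
  have h2 := R.sameSide_walk Q' (u := P.getVert i) (m := i + 2) le_rfl
    (fun k hk hk' => apart_of_add_two_le hP hQ' hk hk') (hk.trans hk') le_rfl hk hk' b c
  rw [SimpleGraph.Walk.getVert_length] at h1 h2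
  exact h1.trans h2

/-- A chord does not separate chords that come before it by at least two. -/
theorem sameSide_earlier {s t : V} {P Q Q' : G.Walk s t} (hP : IsShortest P) (hQ : IsShortest Q)
    (hQ' : IsShortest Q') {i j k : ℕ} (hi : i ≤ P.length) (hj : j + 2 ≤ i) (hk : k + 2 ≤ i)
    (b c : Bool) :
    SameSide (R.endA (P.getVert i)) (R.endB (P.getVert i)) (R.point (Q.getVert j, b))
      (R.point (Q'.getVert k, c)) := by
  have e := hP.length_eq hQ
  have e' := hP.length_eq hQ'
  have h1 := R.sameSide_walk Q (u := P.getVert i) (m := 0) (n := i - 2) (by omega)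
    (fun k hk hk' => (apart_of_add_two_le hQ hP (by omega) hi).symm)
    (i := j) (j := 0) (by omega) (by omega) (by omega) (by omega) b b
  have h2 := R.sameSide_walk Q' (u := P.getVert i) (m := 0) (n := i - 2) (by omega)
    (fun k hk hk' => (apart_of_add_two_le hQ' hP (by omega) hi).symm)
    (i := 0) (j := k) (by omega) (by omega) (by omega) (by omega) b c
  rw [SimpleGraph.Walk.getVert_zero] at h1 h2
  exact h1.trans h2

/-- The orientation of a chord does not depend on the shortest path. -/
theorem tailSide_eq {s t : V} {P Q : G.Walk s t} (hP : IsShortest P) (hQ : IsShortest Q)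
    {i : ℕ} (h0 : 0 < i) (hi : i < P.length) (h : P.getVert i = Q.getVert i) :
    R.tailSide (P.getVert (i - 1)) (P.getVert i) (P.getVert (i + 1)) =
      R.tailSide (Q.getVert (i - 1)) (Q.getVert i) (Q.getVert (i + 1)) := by
  have e := hP.length_eq hQ
  obtain ⟨i, rfl⟩ : ∃ k, i = k + 1 := ⟨i - 1, by omega⟩
  simp only [Nat.add_sub_cancel]
  have a1 : G.Adj (P.getVert i) (P.getVert (i + 1)) := P.adj_getVert_succ (by omega)
  have a2 : G.Adj (P.getVert (i + 1)) (P.getVert (i + 1 + 1)) := P.adj_getVert_succ (by omega)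
  have a3 : G.Adj (Q.getVert i) (Q.getVert (i + 1)) := Q.adj_getVert_succ (by omega)
  have a4 : G.Adj (Q.getVert (i + 1)) (Q.getVert (i + 1 + 1)) := Q.adj_getVert_succ (by omega)
  rw [← h] at a3 a4 ⊢
  have s1 := R.tailSide_spec a1 a2 (apart_of_add_two_le hP hP le_rfl (by omega))
  have s2 := R.tailSide_spec a1 a4 (apart_of_add_two_le hP hQ le_rfl (by omega))
  have s3 := R.tailSide_spec a3 a4 (apart_of_add_two_le hQ hQ le_rfl (by omega))
  -- The previous vertex of `P` and the next vertex of `Q` serve as an intermediate pair, so only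
  -- one neighbour changes at a time. If the orientation changed, both ends of the chord would lie
  -- on one side of the neighbour that is kept, which it crosses.
  trans R.tailSide (P.getVert i) (P.getVert (i + 1)) (Q.getVert (i + 1 + 1))
  · by_contra hne
    refine R.not_sameSide_of_adj a1 (fun h => hne (Bool.not_inj h)) ?_
    refine (s1.2 false).trans ?_
    exact (R.sameSide_later hP hP hQ le_rfl (by omega) le_rfl (by omega) _ _).trans
      (s2.2 false).symm
  · by_contra hne
    refine R.not_sameSide_of_adj a4.symm hne ?_
    refine (s2.1 false).trans ?_
    exact (R.sameSide_earlier hQ hP hQ (by omega) (by omega) (by omega) _ _).trans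
      (s3.1 false).symm

theorem firstEnd_congr {s t : V} {P Q : G.Walk s t} (hP : IsShortest P) (hQ : IsShortest Q)
    {i : ℕ} (h0 : 0 < i) (hi : i < P.length) (h : P.getVert i = Q.getVert i) :
    R.firstEnd P i = R.firstEnd Q i ∧ R.secondEnd P i = R.secondEnd Q i := by
  rw [firstEnd_eq, firstEnd_eq, secondEnd_eq, secondEnd_eq, R.tailSide_eq hP hQ h0 hi h, h]
  exact ⟨rfl, rfl⟩

end ChordRep

end CircleSPR

namespace CircleSPR

variable {V : Type*} {G : SimpleGraph V}

/-! ### Interleaving of positions -/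

/-- The positions `x` and `y` are on the same side of the pair `p`, `q`. -/
def PosSameSide (p q x y : ℝ) : Prop :=
  ((x < p ∨ q < x) ∧ (y < p ∨ q < y)) ∨ (p < x ∧ x < q ∧ p < y ∧ y < q)

theorem IsPosition.sameSide_iff_of_lt {pos : Circle → ℝ} (h : IsPosition pos) {p q : Circle}
    (hpq : pos p < pos q) (x y : Circle) :
    SameSide p q x y ↔ PosSameSide (pos p) (pos q) (pos x) (pos y) := by
  have k : ∀ a b z : ℝ, a < b → (Cyc a b z ↔ z < a ∨ b < z) := by
    intro a b z hab; unfold Cyc; grind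
  have k' : ∀ a b z : ℝ, a < b → (Cyc b a z ↔ a < z ∧ z < b) := by
    intro a b z hab; unfold Cyc; grind
  rw [h.sameSide_iff, k _ _ _ hpq, k _ _ _ hpq, k' _ _ _ hpq, k' _ _ _ hpq, PosSameSide]
  tauto

theorem sameSide_swap {p q x y : Circle} : SameSide p q x y ↔ SameSide q p x y := by
  unfold SameSide
  rw [side_swap p q x, side_swap p q y, neg_mul_neg]

theorem IsPosition.sameSide_iff_of_gt {pos : Circle → ℝ} (h : IsPosition pos) {p q : Circle}
    (hpq : pos q < pos p) (x y : Circle) :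
    SameSide p q x y ↔ PosSameSide (pos q) (pos p) (pos x) (pos y) := by
  rw [sameSide_swap, h.sameSide_iff_of_lt hpq]

/-- Here `s₁, s₂` and `t₁, t₂` are the ends of `s` and `t`, `a, b` and `c, d` the oriented ends of
two consecutive inner chords, and `f₁, f₂` the ends of the chord before them. The separation
conditions on `a, b` and `c, d` leave the claimed order, or a wrong one such as `d < b ≤ c < a` on
the first arc. There some `f` lies between `b` and `a`, and the chain from `s` to `f` would separate
`d` from `t`, against `h₁` and `h₂`. -/
theorem order_of_consecutive {s₁ s₂ t₁ t₂ a b c d f₁ f₂ : ℝ} (hs : s₁ < s₂) (hst : s₂ < t₁)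
    (ht : t₁ < t₂)
    (hb : s₂ < b ∧ ¬(t₁ ≤ b ∧ b ≤ t₂)) (hc : s₂ < c ∧ ¬(t₁ ≤ c ∧ c ≤ t₂))
    (hd : s₂ < d)
    (hab : a < b ∧ ¬ PosSameSide a b c t₁ ∧ ¬ PosSameSide a b c d ∧ ¬ PosSameSide a b f₁ f₂ ∨
      b < a ∧ ¬ PosSameSide b a c t₁ ∧ ¬ PosSameSide b a c d ∧ ¬ PosSameSide b a f₁ f₂)
    (hcd : c < d ∧ ¬ PosSameSide c d b s₁ ∨ d < c ∧ ¬ PosSameSide d c b s₁)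
    (hta : PosSameSide t₁ t₂ a b)
    (hac : a ≠ c) (hdb : d ≠ b)
    (h₁ : s₁ < f₁ → PosSameSide s₁ f₁ d t₁) (h₂ : s₁ < f₂ → PosSameSide s₁ f₂ d t₁) :
    (s₂ < c ∧ c ≤ b ∧ b < t₁) ∨ (t₂ < b ∧ b ≤ c) := by
  unfold PosSameSide at *
  rcases le_or_gt t₁ b with hb1 | hb1 <;> rcases le_or_gt t₁ c with hc1 | hc1 <;>
  rcases hab with hab | hab <;> rcases hcd with hcd | hcd <;> grind

/-! ### The regions between the chords of the end vertices -/

/-- Positions counted from an end point of the chord of `s` such that the end points of the chords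
of `s` and `t` are ordered as `(s, S)`, `(s, !S)`, `(t, T)`, `(t, !T)`. -/
structure IsFrame (R : ChordRep G) (s t : V) (pos : Circle → ℝ) (S T : Bool) : Prop where
  isPosition : IsPosition pos
  le : ∀ x, pos (R.point (s, S)) ≤ pos x
  lt₁ : pos (R.point (s, S)) < pos (R.point (s, !S))
  lt₂ : pos (R.point (s, !S)) < pos (R.point (t, T))
  lt₃ : pos (R.point (t, T)) < pos (R.point (t, !T))

namespace ChordRep

variable (R : ChordRep G)

theorem sameSide_ends (u : V) (b : Bool) {x y : Circle} :
    SameSide (R.endA u) (R.endB u) x y ↔ SameSide (R.point (u, b)) (R.point (u, !b)) x y := by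
  cases b
  · rfl
  · exact sameSide_swap

theorem exists_isFrame {s t : V} (h : Apart G s t) :
    ∃ pos S T, IsFrame R s t pos S T := by
  have hst := h.sameSide (R := R) false true
  -- The ends of `s` are named so that the chord of `t` lies to the left; counting counterclockwise
  -- from the first of them, both ends of `t` then come last.
  have key : ∃ S, ∀ b, 0 < side (R.point (s, S)) (R.point (s, !S)) (R.point (t, b)) := by
    unfold SameSide at hst
    rcases mul_pos_iff.1 hst with ⟨h1, h2⟩ | ⟨h1, h2⟩
    · exact ⟨false, fun b => by cases b <;> assumption⟩
    · refine ⟨true, fun b => ?_⟩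
      simp only [point, Bool.not_true, if_true, Bool.false_eq_true, if_false] at h1 h2 ⊢
      rw [side_swap] at h1 h2
      cases b
      · simpa using h1
      · simpa using h2
  obtain ⟨S, hS⟩ := key
  obtain ⟨pos, hpos, hmin⟩ := exists_isPosition_min (R.point (s, S))
  have hS' := fun b => (hpos.side_pos_iff _ _ _).1 (hS b)
  have hne : pos (R.point (t, false)) ≠ pos (R.point (t, true)) :=
    fun h => R.point_ne t Bool.false_ne_true (hpos.injective h)
  obtain ⟨T, hT⟩ : ∃ T, pos (R.point (t, T)) < pos (R.point (t, !T)) := by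
    rcases lt_or_gt_of_ne hne with h | h
    · exact ⟨false, h⟩
    · exact ⟨true, h⟩
  have h1 := hS' T
  have h2 := hmin (R.point (s, !S))
  have h3 := hmin (R.point (t, T))
  refine ⟨pos, S, T, hpos, hmin, ?_, ?_, hT⟩ <;> unfold Cyc at h1 <;> grind

end ChordRep

namespace IsFrame

variable {R : ChordRep G} {s t : V} {pos : Circle → ℝ} {S T : Bool}

theorem not_behind_source_iff (F : IsFrame R s t pos S T) (x : Circle) (b : Bool) :
    SameSide (R.endA s) (R.endB s) x (R.point (t, b)) ↔ pos (R.point (s, !S)) < pos x := by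
  rw [R.sameSide_ends s S, F.isPosition.sameSide_iff_of_lt F.lt₁]
  have h1 := F.le x
  have h2 := F.lt₁
  have h3 := F.lt₂
  have h4 := F.lt₃
  unfold PosSameSide
  cases b <;> cases T <;> simp only [Bool.not_true, Bool.not_false] at * <;> grind

theorem not_behind_target_iff (F : IsFrame R s t pos S T) (x : Circle) (b : Bool) :
    SameSide (R.endA t) (R.endB t) x (R.point (s, b)) ↔
      ¬ (pos (R.point (t, T)) ≤ pos x ∧ pos x ≤ pos (R.point (t, !T))) := by
  rw [R.sameSide_ends t T, F.isPosition.sameSide_iff_of_lt F.lt₃]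
  have h1 := F.le x
  have h2 := F.lt₁
  have h3 := F.lt₂
  have h4 := F.lt₃
  unfold PosSameSide
  cases b <;> cases S <;> simp only [Bool.not_true, Bool.not_false] at * <;> grind

theorem behind_source_iff (F : IsFrame R s t pos S T) (x : Circle) :
    R.Behind s t x ↔ pos x ≤ pos (R.point (s, !S)) := by
  rw [← not_lt, ← F.not_behind_source_iff x false, SameSide, not_lt]
  rfl

theorem behind_target_iff (F : IsFrame R s t pos S T) (x : Circle) :
    R.Behind t s x ↔ pos (R.point (t, T)) ≤ pos x ∧ pos x ≤ pos (R.point (t, !T)) := by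
  rw [← not_iff_not, ← F.not_behind_target_iff x false, SameSide, ← not_le]
  rfl

/-- The points of one of the two arcs between the chords of `s` and `t`. -/
def Between (R : ChordRep G) (s t : V) (pos : Circle → ℝ) (S T : Bool) (x : Circle) : Prop :=
  pos (R.point (s, !S)) < pos x ∧
    ¬ (pos (R.point (t, T)) ≤ pos x ∧ pos x ≤ pos (R.point (t, !T)))

/-- An equator meets the chords of `s` and `t`, so it has one end behind each of them. This is all
that is used about it. -/
theorem equator_cases (F : IsFrame R s t pos S T) {e₁ e₂ : Circle} (h : R.IsEquator s t e₁ e₂) :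
    (pos e₁ ≤ pos (R.point (s, !S)) ∧
      pos (R.point (t, T)) ≤ pos e₂ ∧ pos e₂ ≤ pos (R.point (t, !T))) ∨
    (pos e₂ ≤ pos (R.point (s, !S)) ∧
      pos (R.point (t, T)) ≤ pos e₁ ∧ pos e₁ ≤ pos (R.point (t, !T))) := by
  obtain ⟨-, hs, ht⟩ := h
  rw [Set.inter_comm, ChordRep.chordOf, chord_inter_iff (R.endA_ne_endB _), R.sameSide_ends _ S,
    F.isPosition.sameSide_iff_of_lt F.lt₁] at hs
  rw [Set.inter_comm, ChordRep.chordOf, chord_inter_iff (R.endA_ne_endB _), R.sameSide_ends _ T,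
    F.isPosition.sameSide_iff_of_lt F.lt₃] at ht
  have h1 := F.le e₁
  have h2 := F.le e₂
  have h3 := F.lt₁
  have h4 := F.lt₂
  have h5 := F.lt₃
  unfold PosSameSide at hs ht
  grind

/-- The equator separates the two arcs between `s` and `t`, whatever its exact end points are. Which
arc is called top depends on it, but equality of letters does not. -/
theorem letter_eq_iff (F : IsFrame R s t pos S T) {e₁ e₂ : Circle} (h : R.IsEquator s t e₁ e₂)
    {x y : Circle} (hx : Between R s t pos S T x) (hy : Between R s t pos S T y) :
    R.letter s t e₁ e₂ x = R.letter s t e₁ e₂ y ↔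
      (pos x < pos (R.point (t, T)) ↔ pos y < pos (R.point (t, T))) := by
  unfold Between at hx hy
  have hc := F.equator_cases h
  have h1 := F.lt₁
  have h2 := F.lt₂
  have h3 := F.lt₃
  simp only [ChordRep.letter, F.behind_source_iff, F.behind_target_iff, not_le.2 hx.1,
    not_le.2 hy.1, hx.2, hy.2, if_false]
  have k : ∀ z, Between R s t pos S T z → (Cyc (pos e₁) (pos e₂) (pos z) ↔
      ((pos e₁ < pos e₂) ↔ pos (R.point (t, T)) ≤ pos z)) := by
    intro z hz
    unfold Between at hz
    unfold Cyc
    grind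
  have kx := (F.isPosition.side_pos_iff e₁ e₂ x).trans (k x hx)
  have ky := (F.isPosition.side_pos_iff e₁ e₂ y).trans (k y hy)
  split_ifs <;> grind

theorem letter_source (F : IsFrame R s t pos S T) (e₁ e₂ : Circle) {x : Circle}
    (hx : ¬ SameSide (R.endA s) (R.endB s) x (R.endA t)) :
    R.letter s t e₁ e₂ x = Letter.source := by
  have := (F.not_behind_source_iff x false).not.1 hx
  rw [not_lt, ← F.behind_source_iff] at this
  simp [ChordRep.letter, this]

theorem letter_target (F : IsFrame R s t pos S T) (e₁ e₂ : Circle) {x : Circle}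
    (hx : SameSide (R.endA s) (R.endB s) x (R.endA t))
    (hx' : ¬ SameSide (R.endA t) (R.endB t) x (R.endA s)) :
    R.letter s t e₁ e₂ x = Letter.target := by
  have h1 := (F.not_behind_source_iff x false).1 hx
  have h2 := (F.not_behind_target_iff x false).not.1 hx'
  rw [not_not, ← F.behind_target_iff] at h2
  rw [← not_le, ← F.behind_source_iff] at h1
  simp [ChordRep.letter, h1, h2]

end IsFrame

namespace ChordRep

variable (R : ChordRep G) {s t : V} {P Q : G.Walk s t}

/-! ### Location of the end points of inner chords -/

/-- The orientation of the chord of an inner vertex of a shortest path. -/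
theorem ends_spec (hP : IsShortest P) {i : ℕ} (hi : i + 2 ≤ P.length) :
    (∀ b, SameSide (R.endA (P.getVert (i + 2))) (R.endB (P.getVert (i + 2)))
        (R.firstEnd P (i + 1)) (R.point (P.getVert i, b))) ∧
      ∀ b, SameSide (R.endA (P.getVert i)) (R.endB (P.getVert i))
        (R.secondEnd P (i + 1)) (R.point (P.getVert (i + 2), b)) := by
  rw [firstEnd_eq, secondEnd_eq]
  exact R.tailSide_spec (P.adj_getVert_succ (by omega)) (P.adj_getVert_succ (by omega))
    (apart_of_add_two_le hP hP le_rfl hi)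

theorem secondEnd_not_behind_source (hP : IsShortest P) {i : ℕ} (h0 : 0 < i)
    (hi : i < P.length) : SameSide (R.endA s) (R.endB s) (R.secondEnd P i) (R.endA t) := by
  have k := R.sameSide_later (P := P) (i := 0) hP hP hP (k := P.length) (c := false)
    -- The chord at position `1` meets that of `s`, so there the orientation is used to compare its
    -- second end with position `2`; later chords avoid the chord of `s` altogether.
    (j := if i = 1 then 2 else i) (by split_ifs <;> omega) (by split_ifs <;> omega) (by omega)
    le_rfl
  rw [P.getVert_zero, P.getVert_length] at k
  split_ifs at k with h1
  · subst h1
    have := (R.ends_spec hP (i := 0) (by omega)).2 false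
    rw [P.getVert_zero] at this
    exact this.trans (k false)
  · rw [secondEnd_eq]
    exact k _

theorem firstEnd_not_behind_target (hP : IsShortest P) {i : ℕ} (h0 : 0 < i)
    (hi : i < P.length) : SameSide (R.endA t) (R.endB t) (R.firstEnd P i) (R.endA s) := by
  have k := R.sameSide_earlier (P := P) (i := P.length) hP hP hP (k := 0) (c := false)
    (j := if i + 1 = P.length then i - 1 else i) le_rfl (by split_ifs <;> omega) (by omega)
  rw [P.getVert_zero, P.getVert_length] at k
  split_ifs at k with h1
  · obtain ⟨i, rfl⟩ : ∃ k, i = k + 1 := ⟨i - 1, by omega⟩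
    have := (R.ends_spec hP (i := i) (by omega)).1 false
    rw [show i + 2 = P.length from h1, P.getVert_length] at this
    exact this.trans (k false)
  · rw [firstEnd_eq]
    exact k _

theorem firstEnd_not_behind_source (hP : IsShortest P) {i : ℕ} (h0 : 2 ≤ i)
    (hi : i < P.length) : SameSide (R.endA s) (R.endB s) (R.firstEnd P i) (R.endA t) := by
  have k := R.sameSide_later (P := P) (i := 0) hP hP hP (k := P.length) (c := false)
    (j := i) (by omega) hi.le (by omega) le_rfl
  rw [P.getVert_zero, P.getVert_length] at k
  rw [firstEnd_eq]
  exact k _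

theorem secondEnd_not_behind_target (hP : IsShortest P) {i : ℕ} (hi : i + 2 ≤ P.length) :
    SameSide (R.endA t) (R.endB t) (R.secondEnd P i) (R.endA s) := by
  have k := R.sameSide_earlier (P := P) (i := P.length) hP hP hP (k := 0) (c := false)
    (j := i) le_rfl hi (by omega)
  rw [P.getVert_zero, P.getVert_length] at k
  rw [secondEnd_eq]
  exact k _

theorem firstEnd_secondEnd (P : G.Walk s t) (i : ℕ) : ∃ b, R.firstEnd P i = R.point (P.getVert i, b) ∧
    R.secondEnd P i = R.point (P.getVert i, !b) :=
  ⟨_, R.firstEnd_eq P i, R.secondEnd_eq P i⟩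

theorem apart_ends (hP : IsShortest P) (hd : 2 ≤ P.length) : Apart G s t := by
  have := apart_of_add_two_le hP hP (i := 0) hd le_rfl
  rwa [P.getVert_zero, P.getVert_length] at this

variable {R}

theorem _root_.CircleSPR.IsFrame.between_first {pos : Circle → ℝ} {S T : Bool}
    (F : IsFrame R s t pos S T) (hP : IsShortest P) {i : ℕ} (h0 : 2 ≤ i) (hi : i < P.length) :
    IsFrame.Between R s t pos S T (R.firstEnd P i) :=
  ⟨(F.not_behind_source_iff _ false).1 (R.firstEnd_not_behind_source hP h0 hi),
    (F.not_behind_target_iff _ false).1 (R.firstEnd_not_behind_target hP (by omega) hi)⟩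

theorem _root_.CircleSPR.IsFrame.between_second {pos : Circle → ℝ} {S T : Bool}
    (F : IsFrame R s t pos S T) (hP : IsShortest P) {i : ℕ} (h0 : 0 < i) (hi : i + 2 ≤ P.length) :
    IsFrame.Between R s t pos S T (R.secondEnd P i) :=
  ⟨(F.not_behind_source_iff _ false).1 (R.secondEnd_not_behind_source hP h0 (by omega)),
    (F.not_behind_target_iff _ false).1 (R.secondEnd_not_behind_target hP hi)⟩

/-- The first end point of a chord comes before the second end point of the previous chord, on the
same arc between the chords of `s` and `t`. -/
theorem _root_.CircleSPR.IsFrame.consecutive {pos : Circle → ℝ} {S T : Bool}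
    (F : IsFrame R s t pos S T) (hP : IsShortest P) {i : ℕ} (h0 : 0 < i) (hi : i + 2 ≤ P.length) :
    (pos (R.point (s, !S)) < pos (R.firstEnd P (i + 1)) ∧
      pos (R.firstEnd P (i + 1)) ≤ pos (R.secondEnd P i) ∧
      pos (R.secondEnd P i) < pos (R.point (t, T))) ∨
    (pos (R.point (t, !T)) < pos (R.secondEnd P i) ∧
      pos (R.secondEnd P i) ≤ pos (R.firstEnd P (i + 1))) := by
  obtain ⟨i, rfl⟩ : ∃ k, i = k + 1 := ⟨i - 1, by omega⟩
  have hb := F.between_second hP h0 hi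
  have hc := F.between_first hP (i := i + 1 + 1) (by omega) (by omega)
  have hd := (F.not_behind_source_iff _ false).1
    (R.secondEnd_not_behind_source hP (i := i + 1 + 1) (by omega) (by omega))
  have su := R.ends_spec hP (i := i) (by omega)
  have sv := R.ends_spec hP (i := i + 1) (by omega)
  have e1 := R.sameSide_later (P := P) (i := i + 1) hP hP hP (j := i + 1 + 2) le_rfl (by omega)
    (k := P.length) (by omega) le_rfl false T
  have e2 := R.sameSide_earlier (P := P) (i := i + 2) hP hP hP (by omega) (j := i) le_rfl
    (k := 0) (by omega) false S
  have e3 := fun b => R.sameSide_earlier (P := P) (i := P.length) hP hP hP le_rfl (j := i + 1)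
    (k := i + 1) (by omega) (by omega) b (!b)
  have e4 := fun b => R.sameSide_of_walks P P (m := 0) (n := i) (m' := i + 2) (n' := P.length)
    (by omega) le_rfl
    (fun k _ hk l hl hl' => apart_of_add_two_le hP hP (by omega) hl')
    (i := 0) (j := i) le_rfl (by omega) (by omega) le_rfl (b := S) (c := b)
    (k := i + 2) (l := P.length) le_rfl (by omega) (by omega) le_rfl
  rw [P.getVert_length] at e1
  rw [P.getVert_zero] at e2
  simp only [P.getVert_zero, P.getVert_length] at e3 e4
  have a1 : G.Adj (P.getVert i) (P.getVert (i + 1)) := P.adj_getVert_succ (by omega)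
  have a2 : G.Adj (P.getVert (i + 1)) (P.getVert (i + 2)) := P.adj_getVert_succ (by omega)
  obtain ⟨b, hb1, hb2⟩ := R.firstEnd_secondEnd P (i + 1)
  obtain ⟨c, hc1, hc2⟩ := R.firstEnd_secondEnd P (i + 1 + 1)
  simp only [show i + 1 + 1 = i + 2 from rfl, show i + 1 + 2 = i + 3 from rfl] at *
  rw [hb1] at su
  rw [hb2] at su hb ⊢
  rw [hc1] at sv hc ⊢
  rw [hc2] at hd sv
  have hne : ∀ (v : V) (b c : Bool), b ≠ c → pos (R.point (v, b)) ≠ pos (R.point (v, c)) :=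
    fun v b c h h' => R.point_ne v h (F.isPosition.injective h')
  have hbn : b ≠ !b := by cases b <;> simp
  have hcn : c ≠ !c := by cases c <;> simp
  -- The second end of the next chord is on the side of `t`; since that chord crosses the present
  -- one, its first end cannot be there as well.
  have c1 : ¬ SameSide (R.endA (P.getVert (i + 1))) (R.endB (P.getVert (i + 1)))
      (R.point (P.getVert (i + 2), c)) (R.point (t, T)) := fun h =>
    R.not_sameSide_of_adj a2 hcn ((h.trans e1.symm).trans (sv.2 false).symm)
  have c2 : ¬ SameSide (R.endA (P.getVert (i + 2))) (R.endB (P.getVert (i + 2)))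
      (R.point (P.getVert (i + 1), !b)) (R.point (s, S)) := fun h =>
    R.not_sameSide_of_adj a2.symm hbn ((su.1 false).trans (e2.trans h.symm))
  have c3 := R.not_sameSide_of_adj a2 hcn
  have c4 := R.not_sameSide_of_adj a1.symm Bool.false_ne_true
  have c5 := e3 b
  have c6 := e4 false (!c) T
  have c7 := e4 true (!c) T
  have c8 : pos (R.point (P.getVert (i + 1), b)) ≠ pos (R.point (P.getVert (i + 2), c)) := by
    intro h
    have := su.1 false
    rw [F.isPosition.injective h, R.sameSide_ends _ c, SameSide, side_left, zero_mul] at this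
    exact lt_irrefl _ this
  have c9 : pos (R.point (P.getVert (i + 2), !c)) ≠ pos (R.point (P.getVert (i + 1), !b)) := by
    intro h
    have := sv.2 false
    rw [F.isPosition.injective h, R.sameSide_ends _ b, SameSide, side_right, zero_mul] at this
    exact lt_irrefl _ this
  rw [R.sameSide_ends _ b] at c1 c3 c4
  rw [R.sameSide_ends _ c] at c2
  rw [R.sameSide_ends _ T, F.isPosition.sameSide_iff_of_lt F.lt₃] at c5
  have hlt : ∀ x, pos (R.point (s, S)) < pos x → R.point (s, S) ≠ x := by
    rintro x h rfl
    exact lt_irrefl _ h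
  refine order_of_consecutive F.lt₁ F.lt₂ F.lt₃ (a := pos (R.point (P.getVert (i + 1), b)))
    (d := pos (R.point (P.getVert (i + 2), !c)))
    (f₁ := pos (R.point (P.getVert i, false))) (f₂ := pos (R.point (P.getVert i, true)))
    hb hc hd ?_ ?_ c5 c8 c9 ?_ ?_
  · rcases lt_or_gt_of_ne (hne (P.getVert (i + 1)) b (!b) hbn) with h | h
    · rw [F.isPosition.sameSide_iff_of_lt h] at c1 c3 c4
      exact Or.inl ⟨h, c1, c3, c4⟩
    · rw [F.isPosition.sameSide_iff_of_gt h] at c1 c3 c4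
      exact Or.inr ⟨h, c1, c3, c4⟩
  · rcases lt_or_gt_of_ne (hne (P.getVert (i + 2)) c (!c) hcn) with h | h
    · rw [F.isPosition.sameSide_iff_of_lt h] at c2
      exact Or.inl ⟨h, c2⟩
    · rw [F.isPosition.sameSide_iff_of_gt h] at c2
      exact Or.inr ⟨h, c2⟩
  · intro h
    exact (F.isPosition.sameSide_iff_of_lt h _ _).1 (c6 (hlt _ h))
  · intro h
    exact (F.isPosition.sameSide_iff_of_lt h _ _).1 (c7 (hlt _ h))

end ChordRep

end CircleSPR

namespace CircleSPR

variable {V : Type*} {G : SimpleGraph V}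

/-! ### Labels and reconfiguration -/

namespace ChordRep

variable {R : ChordRep G} {s t : V} {P Q : G.Walk s t}

theorem label_eq_iff (e₁ e₂ : Circle) (h : P.length = Q.length) :
    R.label e₁ e₂ P = R.label e₁ e₂ Q ↔ ∀ i, 0 < i → i < P.length →
      R.letter s t e₁ e₂ (R.firstEnd P i) = R.letter s t e₁ e₂ (R.firstEnd Q i) ∧
      R.letter s t e₁ e₂ (R.secondEnd P i) = R.letter s t e₁ e₂ (R.secondEnd Q i) := by
  unfold label
  rw [h, List.map_inj_left]
  simp only [List.mem_range, Prod.mk.injEq]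
  constructor
  · intro h i h0 hi
    have := h (i - 1) (by omega)
    rwa [Nat.sub_add_cancel h0] at this
  · intro h j hj
    exact h (j + 1) (by omega) (by omega)

theorem letter_firstEnd_succ (hP : IsShortest P) {i : ℕ} (h0 : 0 < i) (hi : i + 2 ≤ P.length)
    {e₁ e₂ : Circle} (he : R.IsEquator s t e₁ e₂) :
    R.letter s t e₁ e₂ (R.firstEnd P (i + 1)) = R.letter s t e₁ e₂ (R.secondEnd P i) := by
  obtain ⟨pos, S, T, F⟩ := R.exists_isFrame (apart_ends hP (by omega))
  rw [F.letter_eq_iff he (F.between_first hP (by omega) (by omega)) (F.between_second hP h0 hi)]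
  have := F.consecutive hP h0 hi
  have := F.lt₃
  grind

/-- The first chord meets that of `s`, and its second end is on the side of `t`; this leaves the
first end behind `s`. -/
theorem letter_firstEnd_one (hP : IsShortest P) (hd : 2 ≤ P.length) (e₁ e₂ : Circle) :
    R.letter s t e₁ e₂ (R.firstEnd P 1) = Letter.source := by
  obtain ⟨pos, S, T, F⟩ := R.exists_isFrame (apart_ends hP hd)
  refine F.letter_source e₁ e₂ fun h => ?_
  have h1 := R.secondEnd_not_behind_source hP one_pos (by omega)
  obtain ⟨b, hb, hb'⟩ := R.firstEnd_secondEnd P 1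
  rw [hb] at h
  rw [hb'] at h1
  have := P.adj_getVert_succ (i := 0) (by omega)
  rw [P.getVert_zero] at this
  exact R.not_sameSide_of_adj this (by cases b <;> simp) (h.trans h1.symm)

theorem letter_secondEnd_last (hP : IsShortest P) (hd : 2 ≤ P.length) (e₁ e₂ : Circle) :
    R.letter s t e₁ e₂ (R.secondEnd P (P.length - 1)) = Letter.target := by
  obtain ⟨pos, S, T, F⟩ := R.exists_isFrame (apart_ends hP hd)
  refine F.letter_target e₁ e₂ (R.secondEnd_not_behind_source hP (by omega) (by omega))
    fun h => ?_
  have h1 := R.firstEnd_not_behind_target hP (i := P.length - 1) (by omega) (by omega)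
  obtain ⟨b, hb, hb'⟩ := R.firstEnd_secondEnd P (P.length - 1)
  rw [hb'] at h
  rw [hb] at h1
  have := P.adj_getVert_succ (i := P.length - 1) (by omega)
  rw [Nat.sub_add_cancel (by omega), P.getVert_length] at this
  exact R.not_sameSide_of_adj this.symm (by cases b <;> simp) (h1.trans h.symm)

/-- Changing one vertex of a shortest path does not change the label. -/
theorem label_eq_of_step (hP : IsShortest P) (hQ : IsShortest Q) {i : ℕ}
    (h : ∀ j, j ≠ i → P.getVert j = Q.getVert j)
    {e₁ e₂ : Circle} (he : R.IsEquator s t e₁ e₂) : R.label e₁ e₂ P = R.label e₁ e₂ Q := by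
  have hl := hP.length_eq hQ
  rw [label_eq_iff _ _ hl]
  intro j h0 hj
  by_cases hji : j = i
  · have hc : ∀ k, k ≠ i → 0 < k → k < P.length → R.firstEnd P k = R.firstEnd Q k ∧
        R.secondEnd P k = R.secondEnd Q k := fun k hk h0 h1 => R.firstEnd_congr hP hQ h0 h1 (h k hk)
    constructor
    -- At the changed position the first letter is copied from the second letter of the previous
    -- vertex, or is fixed at the start; the second letter is treated symmetrically.
    · by_cases hj1 : j = 1
      · rw [hj1, letter_firstEnd_one hP (by omega), letter_firstEnd_one hQ (by omega)]
      · obtain ⟨j, rfl⟩ : ∃ k, j = k + 1 := ⟨j - 1, by omega⟩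
        rw [letter_firstEnd_succ hP (by omega) (by omega) he,
          letter_firstEnd_succ hQ (by omega) (by omega) he,
          (hc j (by omega) (by omega) (by omega)).2]
    · by_cases hj1 : j = P.length - 1
      · rw [hj1, letter_secondEnd_last hP (by omega), hl, letter_secondEnd_last hQ (by omega)]
      · rw [← letter_firstEnd_succ hP (by omega) (by omega) he,
          ← letter_firstEnd_succ hQ (by omega) (by omega) he,
          (hc (j + 1) (by omega) (by omega) (by omega)).1]
  · obtain ⟨h1, h2⟩ := R.firstEnd_congr hP hQ h0 hj (h j hji)
    rw [h1, h2]
    exact ⟨rfl, rfl⟩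

theorem label_eq_of_reconfigurable (h : Reconfigurable P Q) {e₁ e₂ : Circle}
    (he : R.IsEquator s t e₁ e₂) : R.label e₁ e₂ P = R.label e₁ e₂ Q := by
  obtain ⟨k, W, h0, hk, hW, hstep⟩ := h
  have key : ∀ j ≤ k, R.label e₁ e₂ P = R.label e₁ e₂ (W j) := by
    intro j
    induction j with
    | zero => intro _; rw [h0]
    | succ j ih =>
      intro hj
      rw [ih (by omega)]
      obtain ⟨i, -, hi⟩ := hstep j (by omega)
      exact label_eq_of_step (i := i) (hW j (by omega)) (hW (j + 1) hj)
        (fun l hl => by_contra fun h => hl (hi l h)) he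
  rw [key k le_rfl, hk]

/-! ### Exchangeability of two paths -/

/-- For successive positions, the two paths may be combined in one way or the other. -/
def Exchangeable (P Q : G.Walk s t) : Prop :=
  ∀ i, 0 < i → i + 1 < P.length →
    G.Adj (P.getVert i) (Q.getVert (i + 1)) ∨ G.Adj (Q.getVert i) (P.getVert (i + 1))

/-- If the chords were disjoint, the chain from `s` along `P` to position `i` and the chain along
`Q` from position `i + 1` to `t` would avoid each other. But the pair formed by an end of `s` and
the second end of `P i` interleaves with the first end of `Q (i + 1)` and an end of `t`. -/
theorem adj_of_le {pos : Circle → ℝ} {S T : Bool} (F : IsFrame R s t pos S T) (hP : IsShortest P)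
    (hQ : IsShortest Q) {i : ℕ} (h0 : 0 < i) (hi : i + 1 < P.length)
    (h : (pos (R.point (s, !S)) < pos (R.firstEnd Q (i + 1)) ∧
      pos (R.firstEnd Q (i + 1)) ≤ pos (R.secondEnd P i) ∧
      pos (R.secondEnd P i) < pos (R.point (t, T))) ∨
    (pos (R.point (t, !T)) < pos (R.secondEnd P i) ∧
      pos (R.secondEnd P i) ≤ pos (R.firstEnd Q (i + 1)))) :
    G.Adj (P.getVert i) (Q.getVert (i + 1)) := by
  by_contra hc
  have hl := hP.length_eq hQ
  have ha : ∀ k, 0 ≤ k → k ≤ i → ∀ l, i + 1 ≤ l → l ≤ Q.length →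
      Apart G (P.getVert k) (Q.getVert l) := by
    intro k _ hk l hl1 hl2
    by_cases hkl : k + 2 ≤ l
    · exact apart_of_add_two_le hP hQ hkl hl2
    · obtain rfl : k = i := by omega
      obtain rfl : l = k + 1 := by omega
      exact ⟨fun h => by have := hP.index_eq hQ (by omega) hl2 h; omega, hc⟩
  obtain ⟨b, -, hb⟩ := R.firstEnd_secondEnd P i
  obtain ⟨c, hc, -⟩ := R.firstEnd_secondEnd Q (i + 1)
  rw [hb, hc] at h
  have h1 := F.lt₁
  have h2 := F.lt₂
  have h3 := F.lt₃
  have hlt : pos (R.point (s, S)) < pos (R.point (P.getVert i, !b)) := by grind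
  have k := R.sameSide_of_walks P Q (by omega) le_rfl ha (i := 0) (j := i) (b := S) (c := !b)
    (by omega) (by omega) (by omega) le_rfl
    (k := i + 1) (l := Q.length) (by omega) (by omega) (by omega) le_rfl c T (by
      rw [P.getVert_zero]
      intro h
      rw [h] at hlt
      exact lt_irrefl _ hlt)
  rw [P.getVert_zero, Q.getVert_length, F.isPosition.sameSide_iff_of_lt hlt] at k
  unfold PosSameSide at k
  grind

/-- Equal labels put the second ends of `P i` and `Q i` on one arc. The path whose second end is
farther from `s` reaches at least as far as both next first ends, by `IsFrame.consecutive`, so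
`adj_of_le` applies to it. -/
theorem exchangeable_of_label_eq (hP : IsShortest P) (hQ : IsShortest Q) {e₁ e₂ : Circle}
    (he : R.IsEquator s t e₁ e₂) (h : R.label e₁ e₂ P = R.label e₁ e₂ Q) : Exchangeable P Q := by
  intro i h0 hi
  have hl := hP.length_eq hQ
  obtain ⟨pos, S, T, F⟩ := R.exists_isFrame (apart_ends hP (by omega))
  rw [label_eq_iff _ _ hl] at h
  have h1 := (h i h0 (by omega)).2
  rw [F.letter_eq_iff he (F.between_second hP h0 (by omega))
    (F.between_second hQ h0 (by omega))] at h1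
  have h2 := F.consecutive hP h0 (by omega)
  have h3 := F.consecutive hQ h0 (by omega)
  have h4 := F.lt₃
  by_contra hc
  rw [not_or] at hc
  have h5 := mt (adj_of_le F hP hQ h0 hi) hc.1
  have h6 := mt (adj_of_le F hQ hP h0 (by omega)) hc.2
  grind

theorem exists_isEquator (hP : IsShortest P) (hd : 2 ≤ P.length) (R : ChordRep G) :
    ∃ e₁ e₂, R.IsEquator s t e₁ e₂ := by
  have hst := apart_ends hP hd
  refine ⟨R.endA s, R.endA t, ?_, ?_, ?_⟩
  · intro h
    refine hst.2 ((R.adj_iff s t).2 ⟨hst.1, R.endA s, left_mem_segment ℝ _ _, ?_⟩)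
    rw [h]
    exact left_mem_segment ℝ _ _
  · exact ⟨_, left_mem_segment ℝ _ _, left_mem_segment ℝ _ _⟩
  · exact ⟨_, right_mem_segment ℝ _ _, left_mem_segment ℝ _ _⟩

theorem exchangeable_of_reconfigurable (R : ChordRep G) (hP : IsShortest P) (hQ : IsShortest Q)
    (h : Reconfigurable P Q) : Exchangeable P Q := by
  intro i h0 hi
  obtain ⟨e₁, e₂, he⟩ := exists_isEquator hP (by omega) R
  exact exchangeable_of_label_eq hP hQ he (label_eq_of_reconfigurable h he) i h0 hi

/-! ### Adjacency from the order of the end points -/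

/-- Disjointness of chords in terms of the order of their end points `a`, `b` and `c`, `d`. -/
def Interlace {α : Type*} [LT α] (a b c d : α) : Prop :=
  ¬ ((a < c ∧ c < b ∨ b < c ∧ c < a) ∧ (a < d ∧ d < b ∨ b < d ∧ d < a)) ∧
    ¬ ((c < a ∧ c < b ∨ a < c ∧ b < c) ∧ (d < a ∧ d < b ∨ a < d ∧ b < d))

theorem adj_iff_interlace [Fintype V] {num : V × Bool → ℕ} (h : R.IsNumbering num) {u v : V}
    (huv : u ≠ v) : G.Adj u v ↔
      Interlace (num (u, false)) (num (u, true)) (num (v, false)) (num (v, true)) := by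
  have hp := isPosition_arg
  rw [R.adj_iff, and_iff_right huv, chord_inter_iff (R.endA_ne_endB u), hp.sameSide_iff]
  unfold Interlace
  simp only [h.2]
  change ¬(Cyc (Complex.arg (R.endA u)) (Complex.arg (R.endB u)) (Complex.arg (R.endA v)) ∧
      Cyc (Complex.arg (R.endA u)) (Complex.arg (R.endB u)) (Complex.arg (R.endB v)) ∨
      Cyc (Complex.arg (R.endB u)) (Complex.arg (R.endA u)) (Complex.arg (R.endA v)) ∧
      Cyc (Complex.arg (R.endB u)) (Complex.arg (R.endA u)) (Complex.arg (R.endB v))) ↔ _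
  have e : ∀ (v : V), R.point (v, false) = R.endA v ∧ R.point (v, true) = R.endB v :=
    fun v => ⟨rfl, rfl⟩
  simp only [(e _).1, (e _).2]
  have hne : Complex.arg (R.endA u) ≠ Complex.arg (R.endB u) :=
    fun h => R.endA_ne_endB u (hp.injective h)
  generalize Complex.arg (R.endA u) = a at *
  generalize Complex.arg (R.endB u) = b at *
  generalize Complex.arg (R.endA v) = c at *
  generalize Complex.arg (R.endB v) = d at *
  unfold Cyc
  rcases lt_or_gt_of_ne hne with h | h <;> grind

end ChordRep

/-- The rank of the argument is a numbering of the end points. -/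
theorem ChordRep.exists_isNumbering [Fintype V] (R : ChordRep G) : ∃ num, R.IsNumbering num := by
  classical
  let f : V × Bool → ℝ := fun x => Complex.arg (R.point x : ℂ)
  have hmono : ∀ x y, f x < f y → (Finset.univ.filter fun z => f z < f x).card <
      (Finset.univ.filter fun z => f z < f y).card := by
    intro x y hxy
    refine Finset.card_lt_card ⟨fun z hz => ?_, fun hc => ?_⟩
    · simp only [Finset.mem_filter, Finset.mem_univ, true_and] at hz ⊢
      exact hz.trans hxy
    · have := hc (Finset.mem_filter.2 ⟨Finset.mem_univ x, hxy⟩)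
      simp at this
  refine ⟨fun x => (Finset.univ.filter fun z => f z < f x).card, fun x => ?_, fun x y => ?_⟩
  · have h : (Finset.univ.filter fun z => f z < f x).card < (Finset.univ : Finset (V × Bool)).card :=
      Finset.card_lt_card ⟨Finset.filter_subset _ _, fun hc => by
        have := hc (Finset.mem_univ x)
        simp at this⟩
    rwa [Finset.card_univ, Fintype.card_prod, Fintype.card_bool, mul_comm] at h
  · refine ⟨fun h => ?_, hmono x y⟩
    by_contra hc
    rcases (not_lt.1 hc).lt_or_eq with h1 | h1
    · exact lt_asymm h (hmono _ _ h1)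
    · have : f x = f y := h1.symm
      simp only [this, lt_irrefl] at h

end CircleSPR

namespace CircleSPR

variable {V : Type*} {G : SimpleGraph V}

/-! ### Building a reconfiguration sequence position by position -/

theorem exists_walk_of_adj (d : ℕ) : ∀ {s t : V} (f : ℕ → V), f 0 = s → f d = t →
    (∀ i < d, G.Adj (f i) (f (i + 1))) →
    ∃ W : G.Walk s t, W.length = d ∧ ∀ i ≤ d, W.getVert i = f i := by
  induction d with
  | zero =>
    rintro s t f rfl rfl -
    exact ⟨SimpleGraph.Walk.nil, rfl, fun i hi => by simp [Nat.le_zero.1 hi]⟩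
  | succ d ih =>
    rintro s t f rfl rfl h
    obtain ⟨W, hW, hW'⟩ := ih (fun i => f (i + 1)) rfl rfl fun i hi => h (i + 1) (by omega)
    refine ⟨SimpleGraph.Walk.cons (h 0 (by omega)) W, by simp [hW], fun i hi => ?_⟩
    cases i with
    | zero => simp
    | succ i => simpa using hW' i (by omega)

open Classical in
/-- `W` has the vertices of `Q` in the positions with property `D` and those of `P` elsewhere. -/
def IsMix {s t : V} (P Q W : G.Walk s t) (D : ℕ → Prop) : Prop :=
  ∀ i, W.getVert i = if D i then Q.getVert i else P.getVert i

theorem IsMix.congr {s t : V} {P Q : G.Walk s t} {D D' : ℕ → Prop} {W : G.Walk s t} (h : IsMix P Q W D) (hD : ∀ i, D i ↔ D' i) :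
    IsMix P Q W D' := by
  intro i
  rw [h i]
  congr 1
  exact propext (hD i)

/-- Edges inside a part taken from one path are inherited; only the places where the mixture passes
from one path to the other need an adjacency. -/
theorem exists_isMix {s t : V} {P Q : G.Walk s t} (hP : IsShortest P) (hQ : IsShortest Q)
    {D : ℕ → Prop}
    (h₁ : ∀ i, i < P.length → ¬ D i → D (i + 1) → G.Adj (P.getVert i) (Q.getVert (i + 1)))
    (h₂ : ∀ i, i < P.length → D i → ¬ D (i + 1) → G.Adj (Q.getVert i) (P.getVert (i + 1))) :
    ∃ W, IsShortest W ∧ IsMix P Q W D := by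
  classical
  have hl := hP.length_eq hQ
  obtain ⟨W, hW, hW'⟩ := exists_walk_of_adj (G := G) (s := s) (t := t) P.length
    (fun i => if D i then Q.getVert i else P.getVert i) (by simp)
    (by
      have := Q.getVert_length
      rw [← hl] at this
      simp [this]) (fun i hi => by
      split_ifs with h3 h4 h4
      · exact Q.adj_getVert_succ (by omega)
      · exact h₂ i hi h3 h4
      · exact h₁ i hi h3 h4
      · exact P.adj_getVert_succ hi)
  refine ⟨W, hW.trans hP, fun i => ?_⟩
  rcases le_or_gt i P.length with h | h
  · convert hW' i h
  · rw [W.getVert_of_length_le (by omega), P.getVert_of_length_le (by omega),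
      Q.getVert_of_length_le (by omega), ite_self]

variable [Fintype V] (idx : V ≃ Fin (Fintype.card V))

/-- The first `k` entries of `a` and `b` describe a reconfiguration sequence from `P` to `W`. -/
def Trace {s t : V} (P W : G.Walk s t) (k : ℕ) (a b : ℕ → ℕ) : Prop :=
  ∃ Ws : ℕ → G.Walk s t, IsReconfSeq k Ws P W ∧
    ∀ j < k, (Ws j).getVert (a j) ≠ (Ws (j + 1)).getVert (a j) ∧
      b j = (idx ((Ws (j + 1)).getVert (a j)) : ℕ)

variable {idx}

theorem Trace.step {s t : V} {P W W' : G.Walk s t} {k : ℕ} {a b : ℕ → ℕ}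
    (h : Trace idx P W k a b) (hW' : IsShortest W') {i : ℕ} (hi : W.getVert i ≠ W'.getVert i)
    (hi' : ∀ j, j ≠ i → W.getVert j = W'.getVert j) :
    Trace idx P W' (k + 1) (Function.update a k i)
      (Function.update b k (idx (W'.getVert i) : ℕ)) := by
  obtain ⟨Ws, ⟨h0, hk, hs, hd⟩, ho⟩ := h
  refine ⟨fun j => if j ≤ k then Ws j else W', ⟨by simp [h0], by simp, ?_, ?_⟩, ?_⟩
  · intro j hj
    dsimp only
    split_ifs with h
    · exact hs j h
    · exact hW'
  · intro j hj
    rcases (Nat.lt_succ_iff.1 hj).lt_or_eq with h | rfl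
    · simpa [h.le, h] using hd j h
    · simp only [le_refl, if_true, Nat.not_succ_le_self, if_false, hk]
      exact ⟨i, hi, fun l hl => by_contra fun hc => hl (hi' l hc)⟩
  · intro j hj
    rcases (Nat.lt_succ_iff.1 hj).lt_or_eq with h | rfl
    · simpa [h.le, h, h.ne] using ho j h
    · simp [hk, hi]

/-- The positions before `l` and those from `m` to `r` have been changed; the positions from `l` to
`r` have to be changed in decreasing order. -/
structure Stage (idx : V ≃ Fin (Fintype.card V)) {s t : V} (P Q : G.Walk s t)
    (l r m k : ℕ) (a b : ℕ → ℕ) : Prop where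
  one_le : 1 ≤ l
  le_right : l ≤ r
  right_lt : l < P.length → r < P.length
  le_mid : l ≤ m
  mid_le : m ≤ r + 1
  adj_left : l < P.length → G.Adj (Q.getVert (l - 1)) (P.getVert l)
  adj_mid : ∀ i, l ≤ i → i < r → G.Adj (P.getVert i) (Q.getVert (i + 1))
  trace : ∃ W, IsMix P Q W (fun i => i < l ∨ (m ≤ i ∧ i ≤ r)) ∧ Trace idx P W k a b
  -- At most one step per changed position: `l - 1` of them before the block and `r + 1 - m` inside
  -- it.
  count_le : k + m ≤ l + r
  -- The start value `1` exceeds the length of a path from `s` to itself.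
  left_le : l ≤ P.length ∨ l = 1

namespace Stage

variable {s t : V} {P Q : G.Walk s t} {l r m k : ℕ} {a b : ℕ → ℕ}

theorem init (hP : IsShortest P) (Q : G.Walk s t) (a b : ℕ → ℕ) :
    Stage idx P Q 1 1 2 0 a b := by
  refine ⟨le_rfl, le_rfl, id, by omega, by omega, fun h => ?_, fun i _ _ => by omega,
    ⟨P, fun i => ?_, fun _ => P, ⟨rfl, rfl, fun _ _ => hP, by simp⟩, by simp⟩, by omega,
    Or.inr rfl⟩
  · have := P.adj_getVert_succ (i := 0) (by omega)
    rw [P.getVert_zero] at this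
    simpa using this
  · split_ifs with h
    · obtain rfl : i = 0 := by omega
      simp
    · rfl

/-- Here `m = r + 1` says that nothing in the block has been changed yet, so the mixture stays the
same when the block grows. -/
theorem extend (h : Stage idx P Q l r (r + 1) k a b) (hr : r + 1 < P.length)
    (hadj : G.Adj (P.getVert r) (Q.getVert (r + 1))) :
    Stage idx P Q l (r + 1) (r + 2) k a b := by
  obtain ⟨W, hW, hT⟩ := h.trace
  refine ⟨h.one_le, h.le_right.trans (by omega), fun _ => hr, h.le_right.trans (by omega), le_rfl,
    h.adj_left, fun i hi hi' => ?_, ⟨W, hW.congr fun i => by omega, hT⟩, ?_, h.left_le⟩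
  · rcases (Nat.lt_succ_iff.1 hi').lt_or_eq with h1 | rfl
    · exact h.adj_mid i hi h1
    · exact hadj
  · have := h.count_le
    omega

theorem keep {c : ℕ} (h : Stage idx P Q l r (c + 1) k a b) (hc : l ≤ c)
    (he : P.getVert c = Q.getVert c) : Stage idx P Q l r c k a b := by
  obtain ⟨W, hW, hT⟩ := h.trace
  have hm := h.mid_le
  refine ⟨h.one_le, h.le_right, h.right_lt, hc, by omega,
    h.adj_left, h.adj_mid, ⟨W, fun i => ?_, hT⟩, ?_, h.left_le⟩
  · rw [hW i]
    by_cases hi : i = c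
    · subst hi
      rw [he, ite_self, ite_self]
    · congr 1
      simp only [eq_iff_iff]
      omega
  · have := h.count_le
    omega

/-- After the change the mixture passes between the paths only at the left border of the block,
before `c`, and at its right border. The edges there come from `adj_left`, `adj_mid` and `hadj`;
decreasing order is what makes `adj_mid` the right kind of edge. -/
theorem change {c : ℕ} (h : Stage idx P Q l r (c + 1) k a b) (hP : IsShortest P)
    (hQ : IsShortest Q) (hc : l ≤ c) (hr : r < P.length)
    (hadj : G.Adj (Q.getVert r) (P.getVert (r + 1)))
    (he : P.getVert c ≠ Q.getVert c) : Stage idx P Q l r c (k + 1) (Function.update a k c)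
      (Function.update b k (idx (Q.getVert c) : ℕ)) := by
  obtain ⟨W, hW, hT⟩ := h.trace
  have hm := h.mid_le
  have hl := h.one_le
  refine ⟨h.one_le, h.le_right, h.right_lt, hc, by omega,
    h.adj_left, h.adj_mid, ?_, ?_, h.left_le⟩
  · obtain ⟨W', hW's, hW'⟩ := exists_isMix (D := fun i => i < l ∨ (c ≤ i ∧ i ≤ r)) hP hQ
      (fun i hi h1 h2 => h.adj_mid i (by omega) (by omega))
      (fun i hi h1 h2 => by
        rcases lt_or_ge i l with h3 | h3
        · obtain rfl : l = i + 1 := by omega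
          exact h.adj_left (by omega)
        · obtain rfl : i = r := by omega
          exact hadj)
    refine ⟨W', hW', ?_⟩
    have e : W'.getVert c = Q.getVert c := by
      rw [hW' c, if_pos (Or.inr ⟨le_rfl, by omega⟩)]
    have := hT.step hW's (i := c) (by
      rw [hW c, e, if_neg (by omega)]
      exact he) (fun j hj => by
      rw [hW j, hW' j]
      congr 1
      simp only [eq_iff_iff]
      omega)
    rwa [e] at this
  · have := h.count_le
    omega

/-- A fully changed block joins the finished prefix, and the edge that closed it becomes `adj_left`
of the next block. -/
theorem restart (h : Stage idx P Q l r l k a b) (hr : r < P.length)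
    (hadj : G.Adj (Q.getVert r) (P.getVert (r + 1))) :
    Stage idx P Q (r + 1) (r + 1) (r + 2) k a b := by
  obtain ⟨W, hW, hT⟩ := h.trace
  have h1 := h.le_right
  refine ⟨by omega, le_rfl, id, by omega, le_rfl, fun _ => by simpa using hadj,
    fun i _ _ => by omega, ⟨W, hW.congr fun i => by omega, hT⟩, ?_, Or.inl hr⟩
  have := h.count_le
  omega

theorem done (h : Stage idx P Q l r m k a b) (hP : IsShortest P) (hQ : IsShortest Q)
    (hl : P.length ≤ l) : Trace idx P Q k a b := by
  obtain ⟨W, hW, hT⟩ := h.trace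
  have e := hP.length_eq hQ
  obtain rfl : W = Q := by
    refine SimpleGraph.Walk.ext_getVert fun i => ?_
    rw [hW i]
    split_ifs with h1
    · rfl
    · rw [P.getVert_of_length_le (by omega), Q.getVert_of_length_le (by omega)]
  exact hT

end Stage

/-! ### Programs without loops, and a rule for loops -/

namespace Cmd

/-- The program has no loops. -/
def LoopFree : Cmd → Prop
  | seq c₁ c₂ => c₁.LoopFree ∧ c₂.LoopFree
  | ifLt _ _ c₁ c₂ => c₁.LoopFree ∧ c₂.LoopFree
  | whileLt _ _ _ => False
  | _ => True

/-- The final state of a program without loops. -/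
def exec : Cmd → State → State
  | skip, σ => σ
  | const x c, σ => σ.setReg x c
  | copy x y, σ => σ.setReg x (σ.reg y)
  | succ x, σ => σ.setReg x (σ.reg x + 1)
  | pred x, σ => σ.setReg x (σ.reg x - 1)
  | load x A i, σ => σ.setReg x (σ.arr A (σ.reg i))
  | store A i x, σ => σ.setArr A (σ.reg i) (σ.reg x)
  | seq c₁ c₂, σ => c₂.exec (c₁.exec σ)
  | ifLt x y c₁ c₂, σ => if σ.reg x < σ.reg y then c₁.exec σ else c₂.exec σ
  | whileLt _ _ _, σ => σ

/-- A bound for the number of steps of a program without loops. -/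
def cost : Cmd → ℕ
  | seq c₁ c₂ => c₁.cost + c₂.cost
  | ifLt _ _ c₁ c₂ => 1 + (c₁.cost + c₂.cost)
  | _ => 1

theorem runs_exec (c : Cmd) (h : c.LoopFree) (σ : State) :
    ∃ T, Runs c σ (c.exec σ) T ∧ T ≤ c.cost := by
  induction c generalizing σ with
  | skip => exact ⟨1, Runs.skip σ, le_rfl⟩
  | const x c => exact ⟨1, Runs.const x c σ, le_rfl⟩
  | copy x y => exact ⟨1, Runs.copy x y σ, le_rfl⟩
  | succ x => exact ⟨1, Runs.succ x σ, le_rfl⟩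
  | pred x => exact ⟨1, Runs.pred x σ, le_rfl⟩
  | load x A i => exact ⟨1, Runs.load x A i σ, le_rfl⟩
  | store A i x => exact ⟨1, Runs.store A i x σ, le_rfl⟩
  | seq c₁ c₂ ih₁ ih₂ =>
    obtain ⟨T₁, h₁, hT₁⟩ := ih₁ h.1 σ
    obtain ⟨T₂, h₂, hT₂⟩ := ih₂ h.2 (c₁.exec σ)
    exact ⟨_, Runs.seq h₁ h₂, Nat.add_le_add hT₁ hT₂⟩
  | ifLt x y c₁ c₂ ih₁ ih₂ =>
    by_cases hxy : σ.reg x < σ.reg y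
    · obtain ⟨T, hr, hT⟩ := ih₁ h.1 σ
      refine ⟨_, ?_, Nat.add_le_add_left (hT.trans (Nat.le_add_right _ _)) 1⟩
      simpa only [exec, hxy, if_true] using Runs.ifLt_true hxy hr
    · obtain ⟨T, hr, hT⟩ := ih₂ h.2 σ
      refine ⟨_, ?_, Nat.add_le_add_left (hT.trans (Nat.le_add_left _ _)) 1⟩
      simpa only [exec, hxy, if_false] using Runs.ifLt_false hxy hr
  | whileLt x y c => exact h.elim

/-- A loop with an invariant, and with a measure that decreases in every round. -/
theorem runs_while {x y : ℕ} {c : Cmd} (hc : c.LoopFree) {Inv : State → Prop} {μ : State → ℕ}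
    (h : ∀ σ, Inv σ → σ.reg x < σ.reg y → Inv (c.exec σ) ∧ μ (c.exec σ) < μ σ) (σ : State)
    (hσ : Inv σ) : ∃ σ' T, Runs (whileLt x y c) σ σ' T ∧ T ≤ (c.cost + 1) * μ σ + 1 ∧ Inv σ' ∧
      ¬ σ'.reg x < σ'.reg y := by
  induction hm : μ σ using Nat.strong_induction_on generalizing σ with
  | _ m ih =>
    by_cases hxy : σ.reg x < σ.reg y
    · obtain ⟨h1, h2⟩ := h σ hσ hxy
      obtain ⟨σ', T', hr', hT', hI, hxy'⟩ := ih _ (hm ▸ h2) _ h1 rfl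
      obtain ⟨T, hr, hT⟩ := c.runs_exec hc σ
      refine ⟨σ', _, Runs.whileLt_true hxy hr hr', ?_, hI, hxy'⟩
      have : (c.cost + 1) * (μ (c.exec σ) + 1) ≤ (c.cost + 1) * m :=
        Nat.mul_le_mul_left _ (by omega)
      rw [mul_add] at this
      omega
    · exact ⟨σ, 1, Runs.whileLt_false hxy, by omega, hσ, hxy⟩

end Cmd

end CircleSPR

namespace CircleSPR

/-! ### The program -/

/-- Load the ends of the chords of the vertices in the registers `11` and `12`, those of the first
chord in increasing order. -/
def loadEnds : Cmd :=
  .seq (.load 13 0 11) <| .seq (.load 14 1 11) <| .seq (.load 15 0 12) <| .seq (.load 16 1 12) <|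
  .ifLt 14 13 (.seq (.copy 18 13) <| .seq (.copy 13 14) (.copy 14 18)) .skip

/-- Test whether the chords with the loaded ends intersect. -/
def compareEnds : Cmd :=
  -- Intersection is the default, so coinciding end points count as intersecting; only strict
  -- disjointness resets the answer.
  .seq (.const 17 1) <|
  .ifLt 13 15
    (.ifLt 15 14
      (.ifLt 13 16 (.ifLt 16 14 (.const 17 0) .skip) .skip)
      (.ifLt 14 15
        (.ifLt 16 13 (.const 17 0) (.ifLt 14 16 (.const 17 0) .skip)) .skip))
    (.ifLt 15 13
      (.ifLt 16 13 (.const 17 0) (.ifLt 14 16 (.const 17 0) .skip)) .skip)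

/-- Test whether the chords of the vertices in the registers `11` and `12` intersect. -/
def testAdj : Cmd := .seq loadEnds compareEnds

/-- Test whether the vertex at position `reg 3` in the array `A` and that at position `reg 10` in
the array `B` are adjacent. -/
def probe (A B : ℕ) : Cmd := .seq (.load 11 A 3) <| .seq (.load 12 B 10) testAdj

/-- Extend the current block of positions, or start to change the positions of the block; stop if
the paths turn out not to be exchangeable. -/
def scan : Cmd :=
  .seq (.seq (.copy 10 3) (.succ 10)) <|
  -- Closing the block is tried first, by testing `Q r` against `P (r + 1)`. Register `9` holds `1`,
  -- so `17 < 9` means that the chords are disjoint. On failure of both tests the loop is ended by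
  -- setting `l` to the length.
  .ifLt 10 1
    (.seq (probe 3 2) <|
      .ifLt 17 9
        (.seq (probe 2 3) <|
          .ifLt 17 9 (.seq (.const 6 0) (.copy 2 1)) (.copy 3 10))
        (.seq (.copy 4 3) (.const 5 1)))
    (.seq (.copy 4 3) (.const 5 1))

/-- Write one step of the reconfiguration sequence. -/
def output : Cmd := .seq (.store 4 7 4) <| .seq (.store 5 7 12) (.succ 7)

/-- Change the position `reg 4`, if the paths differ there. -/
def change : Cmd :=
  .seq (.load 11 2 4) <| .seq (.load 12 3 4) <| .ifLt 11 12 output (.ifLt 12 11 output .skip)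

/-- Go to the next position of the block, or to the next block. -/
def advance : Cmd := .ifLt 2 4 (.pred 4) (.seq (.succ 3) <| .seq (.copy 2 3) (.const 5 0))

/-- Change one position of the current block. -/
def emit : Cmd := .seq change advance

/-- The body of the loop. -/
def round : Cmd := .ifLt 5 9 scan emit

/-- The assignments before the loop. -/
def setup : Cmd :=
  -- Registers `2`, `3`, `4` hold `l`, `r` and the position to be changed; `5` is `0` while scanning
  -- and `1` while changing; `6` is the answer and `7` counts the steps.
  .seq (.const 9 1) <| .seq (.const 2 1) <| .seq (.const 3 1) (.const 6 1)

/-- The program that decides reconfigurability and writes a reconfiguration sequence. -/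
def program : Cmd :=
  .seq setup <| .seq (.whileLt 2 1 round) <| .seq (.copy 0 6) (.copy 1 7)

/-! ### Effect of the loop-free pieces of the program -/

theorem State.setReg_arr (σ : State) (x a : ℕ) : (σ.setReg x a).arr = σ.arr := rfl

theorem State.setReg_reg (σ : State) (x a y : ℕ) :
    (σ.setReg x a).reg y = if y = x then a else σ.reg y :=
  Function.update_apply _ _ _ _

theorem exec_loadEnds (σ : State) : (loadEnds.exec σ).arr = σ.arr ∧
    (∀ x < 13, (loadEnds.exec σ).reg x = σ.reg x) ∧
    (loadEnds.exec σ).reg 13 = min (σ.arr 0 (σ.reg 11)) (σ.arr 1 (σ.reg 11)) ∧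
    (loadEnds.exec σ).reg 14 = max (σ.arr 0 (σ.reg 11)) (σ.arr 1 (σ.reg 11)) ∧
    (loadEnds.exec σ).reg 15 = σ.arr 0 (σ.reg 12) ∧
    (loadEnds.exec σ).reg 16 = σ.arr 1 (σ.reg 12) := by
  have hx : ∀ x < 13, x ≠ 13 ∧ x ≠ 14 ∧ x ≠ 15 ∧ x ≠ 16 ∧ x ≠ 18 := by omega
  simp only [loadEnds, Cmd.exec, State.setReg_arr, State.setReg_reg, Nat.reduceEqDiff, if_true, if_false]
  split_ifs with h
  · simp only [State.setReg_arr, State.setReg_reg, Nat.reduceEqDiff,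
      if_true, if_false, true_and, and_true]
    exact ⟨fun x h => by simp [hx x h], by omega, by omega⟩
  · simp only [State.setReg_arr, State.setReg_reg, Nat.reduceEqDiff,
      if_true, if_false, true_and, and_true]
    exact ⟨fun x h => by simp [hx x h], by omega, by omega⟩

/-- With the ends of the first chord sorted, few comparisons decide the question;
`interlace_min_max` justifies the sorting. -/
theorem exec_compareEnds (σ : State) (hle : σ.reg 13 ≤ σ.reg 14) :
    (compareEnds.exec σ).arr = σ.arr ∧
    (∀ x < 13, (compareEnds.exec σ).reg x = σ.reg x) ∧
    ((compareEnds.exec σ).reg 17 < 1 ↔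
      ¬ ChordRep.Interlace (σ.reg 13) (σ.reg 14) (σ.reg 15) (σ.reg 16)) := by
  have hx : ∀ x < 13, x ≠ 17 := by omega
  have h1 : ∀ x < 13, ((σ.setReg 17 1).setReg 17 0).reg x = σ.reg x :=
    fun x h => by simp [State.setReg_reg, hx x h]
  have h2 : ∀ x < 13, (σ.setReg 17 1).reg x = σ.reg x :=
    fun x h => by simp [State.setReg_reg, hx x h]
  simp only [compareEnds, Cmd.exec, State.setReg_reg, Nat.reduceEqDiff,
    if_false, ChordRep.Interlace]
  split_ifs <;> refine ⟨rfl, by assumption, ?_⟩ <;>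
    simp only [State.setReg_reg, if_true] <;> omega

theorem interlace_min_max (a b c d : ℕ) :
    ChordRep.Interlace (min a b) (max a b) c d ↔ ChordRep.Interlace a b c d := by
  rcases le_total a b with h | h
  · rw [min_eq_left h, max_eq_right h]
  · rw [min_eq_right h, max_eq_left h]
    unfold ChordRep.Interlace
    omega

theorem exec_testAdj (σ : State) : (testAdj.exec σ).arr = σ.arr ∧
    (∀ x < 13, (testAdj.exec σ).reg x = σ.reg x) ∧
    ((testAdj.exec σ).reg 17 < 1 ↔ ¬ ChordRep.Interlace (σ.arr 0 (σ.reg 11))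
      (σ.arr 1 (σ.reg 11)) (σ.arr 0 (σ.reg 12)) (σ.arr 1 (σ.reg 12))) := by
  obtain ⟨h1, h2, h3, h4, h5, h6⟩ := exec_loadEnds σ
  obtain ⟨h7, h8, h9⟩ := exec_compareEnds (loadEnds.exec σ) (by
    rw [h3, h4]
    exact min_le_max)
  rw [h3, h4, h5, h6, interlace_min_max] at h9
  exact ⟨h7.trans h1, fun x hx => (h8 x hx).trans (h2 x hx), h9⟩

end CircleSPR

namespace CircleSPR

theorem exec_probe (A B : ℕ) (σ : State) : ((probe A B).exec σ).arr = σ.arr ∧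
    (∀ x < 11, ((probe A B).exec σ).reg x = σ.reg x) ∧
    (((probe A B).exec σ).reg 17 < 1 ↔
      ¬ ChordRep.Interlace (σ.arr 0 (σ.arr A (σ.reg 3))) (σ.arr 1 (σ.arr A (σ.reg 3)))
        (σ.arr 0 (σ.arr B (σ.reg 10))) (σ.arr 1 (σ.arr B (σ.reg 10)))) := by
  have hx : ∀ x < 11, x ≠ 11 ∧ x ≠ 12 := by omega
  obtain ⟨h1, h2, h3⟩ := exec_testAdj
    ((σ.setReg 11 (σ.arr A (σ.reg 3))).setReg 12 (σ.arr B (σ.reg 10)))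
  have e : (probe A B).exec σ = testAdj.exec
      ((σ.setReg 11 (σ.arr A (σ.reg 3))).setReg 12 (σ.arr B (σ.reg 10))) := rfl
  rw [e]
  simp only [State.setReg_arr, State.setReg_reg, Nat.reduceEqDiff, if_true, if_false] at h1 h2 h3
  refine ⟨h1, fun x h => ?_, h3⟩
  rw [h2 x (by omega), if_neg (hx x h).2, if_neg (hx x h).1]

/-- The outcomes of `scan`. -/
theorem exec_scan (σ : State) (h9 : σ.reg 9 = 1) :
    (scan.exec σ).arr = σ.arr ∧ (scan.exec σ).reg 1 = σ.reg 1 ∧ (scan.exec σ).reg 7 = σ.reg 7 ∧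
    (scan.exec σ).reg 9 = 1 ∧
    ((σ.reg 3 + 1 < σ.reg 1 ∧
      ¬ ChordRep.Interlace (σ.arr 0 (σ.arr 3 (σ.reg 3))) (σ.arr 1 (σ.arr 3 (σ.reg 3)))
        (σ.arr 0 (σ.arr 2 (σ.reg 3 + 1))) (σ.arr 1 (σ.arr 2 (σ.reg 3 + 1))) ∧
      ¬ ChordRep.Interlace (σ.arr 0 (σ.arr 2 (σ.reg 3))) (σ.arr 1 (σ.arr 2 (σ.reg 3)))
        (σ.arr 0 (σ.arr 3 (σ.reg 3 + 1))) (σ.arr 1 (σ.arr 3 (σ.reg 3 + 1))) ∧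
      (scan.exec σ).reg 6 = 0 ∧ (scan.exec σ).reg 2 = σ.reg 1 ∧
      (scan.exec σ).reg 3 = σ.reg 3 ∧ (scan.exec σ).reg 5 = σ.reg 5) ∨
    (σ.reg 3 + 1 < σ.reg 1 ∧
      ChordRep.Interlace (σ.arr 0 (σ.arr 2 (σ.reg 3))) (σ.arr 1 (σ.arr 2 (σ.reg 3)))
        (σ.arr 0 (σ.arr 3 (σ.reg 3 + 1))) (σ.arr 1 (σ.arr 3 (σ.reg 3 + 1))) ∧
      (scan.exec σ).reg 6 = σ.reg 6 ∧ (scan.exec σ).reg 2 = σ.reg 2 ∧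
      (scan.exec σ).reg 3 = σ.reg 3 + 1 ∧ (scan.exec σ).reg 5 = σ.reg 5) ∨
    ((σ.reg 3 + 1 < σ.reg 1 →
      ChordRep.Interlace (σ.arr 0 (σ.arr 3 (σ.reg 3))) (σ.arr 1 (σ.arr 3 (σ.reg 3)))
        (σ.arr 0 (σ.arr 2 (σ.reg 3 + 1))) (σ.arr 1 (σ.arr 2 (σ.reg 3 + 1)))) ∧
      (scan.exec σ).reg 6 = σ.reg 6 ∧ (scan.exec σ).reg 2 = σ.reg 2 ∧
      (scan.exec σ).reg 3 = σ.reg 3 ∧ (scan.exec σ).reg 4 = σ.reg 3 ∧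
      (scan.exec σ).reg 5 = 1)) := by
  have hx : ∀ x < 10, x ≠ 10 := by omega
  obtain ⟨τ, hτ⟩ : ∃ τ, τ = (Cmd.seq (.copy 10 3) (.succ 10)).exec σ := ⟨_, rfl⟩
  have e : scan.exec σ = if τ.reg 10 < τ.reg 1 then
      (if ((probe 3 2).exec τ).reg 17 < ((probe 3 2).exec τ).reg 9 then
        (if ((probe 2 3).exec ((probe 3 2).exec τ)).reg 17 <
            ((probe 2 3).exec ((probe 3 2).exec τ)).reg 9 then
          (Cmd.seq (.const 6 0) (.copy 2 1)).exec ((probe 2 3).exec ((probe 3 2).exec τ))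
          else (Cmd.copy 3 10).exec ((probe 2 3).exec ((probe 3 2).exec τ)))
        else (Cmd.seq (.copy 4 3) (.const 5 1)).exec ((probe 3 2).exec τ))
      else (Cmd.seq (.copy 4 3) (.const 5 1)).exec τ := by
    rw [hτ]
    rfl
  have t1 : τ.arr = σ.arr := by rw [hτ]; rfl
  have t2 : ∀ x < 10, τ.reg x = σ.reg x := by
    intro x h
    rw [hτ]
    simp [Cmd.exec, State.setReg_reg, hx x h]
  have t3 : τ.reg 10 = σ.reg 3 + 1 := by
    rw [hτ]
    simp [Cmd.exec, State.setReg_reg]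
  obtain ⟨a1, a2, a3⟩ := exec_probe 3 2 τ
  generalize (probe 3 2).exec τ = τ₁ at *
  obtain ⟨b1, b2, b3⟩ := exec_probe 2 3 τ₁
  generalize (probe 2 3).exec τ₁ = τ₂ at *
  rw [a1, t1, a2 10 (by norm_num), t3, a2 3 (by norm_num), t2 3 (by norm_num)] at b3
  rw [t1, t3, t2 3 (by norm_num)] at a3
  have c1 : ∀ x < 10, τ₁.reg x = σ.reg x := fun x h => (a2 x (by omega)).trans (t2 x h)
  have c2 : ∀ x < 10, τ₂.reg x = σ.reg x := fun x h => (b2 x (by omega)).trans (c1 x h)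
  have c3 : τ₂.reg 10 = σ.reg 3 + 1 := ((b2 10 (by norm_num)).trans (a2 10 (by norm_num))).trans t3
  have c4 : τ₁.arr = σ.arr := a1.trans t1
  have c5 : τ₂.arr = σ.arr := b1.trans c4
  rw [t3, t2 1 (by norm_num), c1 9 (by norm_num), c2 9 (by norm_num), h9] at e
  rw [e]
  clear e
  split_ifs with h1 h2 h3
  · refine ⟨c5, ?_, ?_, ?_, Or.inl ⟨h1, a3.1 h2, b3.1 h3, ?_⟩⟩ <;>
      simp [Cmd.exec, State.setReg_reg, c2, h9]
  · refine ⟨c5, ?_, ?_, ?_, Or.inr (Or.inl ⟨h1, not_not.1 (mt b3.2 h3), ?_⟩)⟩ <;>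
      simp [Cmd.exec, State.setReg_reg, c2, c3, h9]
  · refine ⟨c4, ?_, ?_, ?_, Or.inr (Or.inr ⟨fun _ => not_not.1 (mt a3.2 h2), ?_⟩)⟩ <;>
      simp [Cmd.exec, State.setReg_reg, c1, h9]
  · refine ⟨t1, ?_, ?_, ?_, Or.inr (Or.inr ⟨fun h => absurd h h1, ?_⟩)⟩ <;>
      simp [Cmd.exec, State.setReg_reg, t2, h9]

theorem exec_output (σ : State) : (∀ A < 4, (output.exec σ).arr A = σ.arr A) ∧
    (∀ x < 7, (output.exec σ).reg x = σ.reg x) ∧ (output.exec σ).reg 9 = σ.reg 9 ∧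
    (output.exec σ).reg 7 = σ.reg 7 + 1 ∧
    (output.exec σ).arr 4 = Function.update (σ.arr 4) (σ.reg 7) (σ.reg 4) ∧
    (output.exec σ).arr 5 = Function.update (σ.arr 5) (σ.reg 7) (σ.reg 12) := by
  have hA : ∀ A < 4, A ≠ 4 ∧ A ≠ 5 := by omega
  have hx : ∀ x < 7, x ≠ 7 := by omega
  simp only [output, Cmd.exec, State.setArr, State.setReg_reg, State.setReg_arr]
  refine ⟨fun A h => ?_, fun x h => ?_, ?_, ?_, ?_, ?_⟩
  · simp [hA A h]
  · simp [hx x h]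
  all_goals simp

theorem exec_change (σ : State) : (∀ A < 4, (change.exec σ).arr A = σ.arr A) ∧
    (∀ x < 7, (change.exec σ).reg x = σ.reg x) ∧ (change.exec σ).reg 9 = σ.reg 9 ∧
    ((σ.arr 2 (σ.reg 4) = σ.arr 3 (σ.reg 4) ∧ (change.exec σ).arr = σ.arr ∧
      (change.exec σ).reg 7 = σ.reg 7) ∨
    (σ.arr 2 (σ.reg 4) ≠ σ.arr 3 (σ.reg 4) ∧ (change.exec σ).reg 7 = σ.reg 7 + 1 ∧
      (change.exec σ).arr 4 = Function.update (σ.arr 4) (σ.reg 7) (σ.reg 4) ∧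
      (change.exec σ).arr 5 = Function.update (σ.arr 5) (σ.reg 7) (σ.arr 3 (σ.reg 4)))) := by
  have hx : ∀ x < 10, x ≠ 11 ∧ x ≠ 12 := by omega
  obtain ⟨τ, hτ⟩ : ∃ τ, τ = (Cmd.seq (.load 11 2 4) (.load 12 3 4)).exec σ := ⟨_, rfl⟩
  have e : change.exec σ = if τ.reg 11 < τ.reg 12 then output.exec τ
      else if τ.reg 12 < τ.reg 11 then output.exec τ else τ := by
    rw [hτ]
    rfl
  have t1 : τ.arr = σ.arr := by rw [hτ]; rfl
  have t2 : ∀ x < 10, τ.reg x = σ.reg x := by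
    intro x h
    rw [hτ]
    simp [Cmd.exec, State.setReg_reg, hx x h]
  have t3 : τ.reg 11 = σ.arr 2 (σ.reg 4) ∧ τ.reg 12 = σ.arr 3 (σ.reg 4) := by
    rw [hτ]
    simp [Cmd.exec, State.setReg_reg, State.setReg_arr]
  obtain ⟨o1, o2, o3, o4, o5, o6⟩ := exec_output τ
  rw [t1, t2 7 (by norm_num)] at o5 o6
  rw [t2 4 (by norm_num)] at o5
  rw [t3.2] at o6
  have key : (σ.arr 2 (σ.reg 4) = σ.arr 3 (σ.reg 4) ∧ change.exec σ = τ) ∨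
      (σ.arr 2 (σ.reg 4) ≠ σ.arr 3 (σ.reg 4) ∧ change.exec σ = output.exec τ) := by
    rw [e, ← t3.1, ← t3.2]
    split_ifs with h1 h2
    · exact Or.inr ⟨h1.ne, rfl⟩
    · exact Or.inr ⟨h2.ne', rfl⟩
    · exact Or.inl ⟨by omega, rfl⟩
  rcases key with ⟨h, h'⟩ | ⟨h, h'⟩ <;> rw [h']
  · exact ⟨fun A _ => by rw [t1], fun x hx => t2 x (by omega), t2 9 (by norm_num),
      Or.inl ⟨h, t1, t2 7 (by norm_num)⟩⟩
  · exact ⟨fun A hA => (o1 A hA).trans (by rw [t1]), fun x hx => (o2 x hx).trans (t2 x (by omega)),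
      o3.trans (t2 9 (by norm_num)), Or.inr ⟨h, o4.trans (by rw [t2 7 (by norm_num)]), o5, o6⟩⟩

theorem exec_advance (σ : State) : (advance.exec σ).arr = σ.arr ∧
    (advance.exec σ).reg 1 = σ.reg 1 ∧ (advance.exec σ).reg 6 = σ.reg 6 ∧
    (advance.exec σ).reg 7 = σ.reg 7 ∧ (advance.exec σ).reg 9 = σ.reg 9 ∧
    ((σ.reg 2 < σ.reg 4 ∧ (advance.exec σ).reg 4 = σ.reg 4 - 1 ∧
      (advance.exec σ).reg 2 = σ.reg 2 ∧ (advance.exec σ).reg 3 = σ.reg 3 ∧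
      (advance.exec σ).reg 5 = σ.reg 5) ∨
    (¬ σ.reg 2 < σ.reg 4 ∧ (advance.exec σ).reg 2 = σ.reg 3 + 1 ∧
      (advance.exec σ).reg 3 = σ.reg 3 + 1 ∧ (advance.exec σ).reg 5 = 0)) := by
  simp only [advance, Cmd.exec]
  split_ifs with h <;> simp [State.setReg_reg, State.setReg_arr, h]

/-! ### Correctness of the program -/

variable {V : Type*} {G : SimpleGraph V} [Fintype V] {idx : V ≃ Fin (Fintype.card V)}

/-- The invariant of the loop. -/
structure LoopInv (idx : V ≃ Fin (Fintype.card V)) (num : V × Bool → ℕ) {s t : V}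
    (P Q : G.Walk s t) (σ : State) : Prop where
  input : ∀ A < 4, σ.arr A = (inputState idx num P Q).arr A
  length : σ.reg 1 = P.length
  one : σ.reg 9 = 1
  cases : (σ.reg 6 = 0 ∧ P.length ≤ σ.reg 2 ∧ ¬ ChordRep.Exchangeable P Q) ∨
    (σ.reg 6 = 1 ∧ σ.reg 5 = 0 ∧
      Stage idx P Q (σ.reg 2) (σ.reg 3) (σ.reg 3 + 1) (σ.reg 7) (σ.arr 4) (σ.arr 5)) ∨
    (σ.reg 6 = 1 ∧ σ.reg 5 = 1 ∧
      Stage idx P Q (σ.reg 2) (σ.reg 3) (σ.reg 4 + 1) (σ.reg 7) (σ.arr 4) (σ.arr 5) ∧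
      σ.reg 2 ≤ σ.reg 4 ∧ σ.reg 4 ≤ σ.reg 3 ∧ σ.reg 3 < P.length ∧
      G.Adj (Q.getVert (σ.reg 3)) (P.getVert (σ.reg 3 + 1)))

/-- The measure of the loop: a bound for the number of remaining rounds. -/
def loopMeasure (d : ℕ) (σ : State) : ℕ :=
  if σ.reg 5 = 0 then 3 * d - 2 * σ.reg 2 - σ.reg 3
  else σ.reg 4 + 1 - σ.reg 2 + 3 * (d - σ.reg 3 - 1)

theorem inputState_interlace (R : ChordRep G) {num : V × Bool → ℕ} (hnum : R.IsNumbering num)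
    {s t : V} (P Q : G.Walk s t) {u v : V} (huv : u ≠ v) :
    ChordRep.Interlace ((inputState idx num P Q).arr 0 (idx u))
      ((inputState idx num P Q).arr 1 (idx u)) ((inputState idx num P Q).arr 0 (idx v))
      ((inputState idx num P Q).arr 1 (idx v)) ↔ G.Adj u v := by
  rw [ChordRep.adj_iff_interlace hnum huv]
  simp [inputState]

theorem inputState_arr_two (num : V × Bool → ℕ) {s t : V} (P Q : G.Walk s t) {i : ℕ}
    (hi : i ≤ P.length) : (inputState idx num P Q).arr 2 i = idx (P.getVert i) := by
  simp [inputState, hi]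

theorem inputState_arr_three (num : V × Bool → ℕ) {s t : V} (P Q : G.Walk s t) {i : ℕ}
    (hi : i ≤ Q.length) : (inputState idx num P Q).arr 3 i = idx (Q.getVert i) := by
  simp [inputState, hi]

theorem loopInv_scan {R : ChordRep G} {num : V × Bool → ℕ} (hnum : R.IsNumbering num) {s t : V}
    {P Q : G.Walk s t} (hP : IsShortest P) (hQ : IsShortest Q) {σ : State}
    (h : LoopInv idx num P Q σ) (h5 : σ.reg 5 = 0) (hlt : σ.reg 2 < P.length) :
    LoopInv idx num P Q (scan.exec σ) ∧
      loopMeasure P.length (scan.exec σ) < loopMeasure P.length σ := by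
  have hl := hP.length_eq hQ
  obtain ⟨hin, h1, h9, hcases⟩ := h
  rcases hcases with ⟨-, h, -⟩ | ⟨h6, -, hS⟩ | ⟨-, h, -⟩
  · omega
  · have hr := hS.right_lt hlt
    have hlr := hS.le_right
    have hl1 := hS.one_le
    have n1 : Q.getVert (σ.reg 3) ≠ P.getVert (σ.reg 3 + 1) := fun h => by
      have := hQ.index_eq hP (by omega) (by omega) h
      omega
    have n2 : P.getVert (σ.reg 3) ≠ Q.getVert (σ.reg 3 + 1) := fun h => by
      have := hP.index_eq hQ (by omega) (by omega) h
      omega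
    obtain ⟨s1, s2, s3, s4, s5⟩ := exec_scan σ h9
    rw [hin 0 (by norm_num), hin 1 (by norm_num), hin 2 (by norm_num), hin 3 (by norm_num), h1,
      inputState_arr_two _ _ _ (by omega), inputState_arr_two _ _ _ (by omega),
      inputState_arr_three _ _ _ (by omega), inputState_arr_three _ _ _ (by omega),
      inputState_interlace R hnum P Q n1, inputState_interlace R hnum P Q n2] at s5
    generalize scan.exec σ = σ' at *
    unfold loopMeasure
    rcases s5 with ⟨a0, a1, a2, a3, a4, a5, a6⟩ | ⟨a0, a1, a3, a4, a5, a6⟩ |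
      ⟨a1, a3, a4, a5, a6, a7⟩
    · refine ⟨⟨by rwa [s1], s2.trans h1, s4, Or.inl ⟨a3, a4.ge, fun hE => ?_⟩⟩, ?_⟩
      · rcases hE _ (by omega) a0 with h | h
        · exact a2 h
        · exact a1 h
      · rw [a6, h5, if_pos rfl, if_pos rfl]
        omega
    · refine ⟨⟨by rwa [s1], s2.trans h1, s4, Or.inr (Or.inl ⟨a3.trans h6, a6.trans h5, ?_⟩)⟩, ?_⟩
      · rw [a4, a5, s3, s1]
        exact hS.extend a0 a1
      · rw [a6, h5, if_pos rfl, if_pos rfl]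
        omega
    · refine ⟨⟨by rwa [s1], s2.trans h1, s4, Or.inr (Or.inr ⟨a3.trans h6, a7, ?_⟩)⟩, ?_⟩
      · rw [a4, a5, a6, s3, s1]
        refine ⟨hS, hlr, le_rfl, hr, ?_⟩
        -- At the last inner position the block closes without a test, since both paths continue to
        -- `t`.
        rcases lt_or_ge (σ.reg 3 + 1) P.length with h | h
        · exact a1 h
        · have e : P.getVert (σ.reg 3 + 1) = Q.getVert (σ.reg 3 + 1) := by
            rw [P.getVert_of_length_le h, Q.getVert_of_length_le (by omega)]
          rw [e]
          exact Q.adj_getVert_succ (by omega)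
      -- With `c = r` the measure falls from `3d - 2l - r` to `3d - l - 2r - 2`, where `d` is the
      -- length; the difference `r - l + 2` is positive.
      · rw [a7, h5, if_pos rfl, if_neg one_ne_zero]
        omega
  · omega

theorem loopInv_emit {num : V × Bool → ℕ} {s t : V}
    {P Q : G.Walk s t} (hP : IsShortest P) (hQ : IsShortest Q) {σ : State}
    (h : LoopInv idx num P Q σ) (h5 : σ.reg 5 ≠ 0) (hlt : σ.reg 2 < P.length) :
    LoopInv idx num P Q (emit.exec σ) ∧
      loopMeasure P.length (emit.exec σ) < loopMeasure P.length σ := by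
  have hl := hP.length_eq hQ
  obtain ⟨hin, h1, h9, hcases⟩ := h
  rcases hcases with ⟨-, h, -⟩ | ⟨-, h, -⟩ | ⟨h6, h5, hS, hlc, hcr, hr, hadj⟩
  · omega
  · exact absurd h h5
  · obtain ⟨c1, c2, c3, c4⟩ := exec_change σ
    have e : emit.exec σ = advance.exec (change.exec σ) := rfl
    rw [hin 2 (by norm_num), hin 3 (by norm_num), inputState_arr_two _ _ _ (by omega),
      inputState_arr_three _ _ _ (by omega)] at c4
    have hS' : Stage idx P Q (σ.reg 2) (σ.reg 3) (σ.reg 4) ((change.exec σ).reg 7)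
        ((change.exec σ).arr 4) ((change.exec σ).arr 5) := by
      rcases c4 with ⟨d1, d2, d3⟩ | ⟨d1, d2, d3, d4⟩
      · rw [d2, d3]
        exact hS.keep hlc (idx.injective (Fin.ext d1))
      · rw [d2, d3, d4]
        exact hS.change hP hQ hlc hr hadj fun h => d1 (by rw [h])
    rw [e]
    generalize change.exec σ = τ at *
    obtain ⟨a1, a2, a3, a4, a5, a6⟩ := exec_advance τ
    rw [c2 1 (by norm_num)] at a2
    rw [c2 6 (by norm_num)] at a3
    rw [c2 2 (by norm_num), c2 3 (by norm_num), c2 4 (by norm_num), c2 5 (by norm_num)] at a6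
    generalize advance.exec τ = σ' at *
    rw [← a1, ← a4] at hS'
    have i1 : ∀ A < 4, σ'.arr A = (inputState idx num P Q).arr A :=
      fun A hA => (by rw [a1, c1 A hA, hin A hA])
    have i2 : σ'.reg 9 = 1 := by rw [a5, c3, h9]
    unfold loopMeasure
    rcases a6 with ⟨b1, b2, b3, b4, b5⟩ | ⟨b1, b2, b3, b4⟩
    · refine ⟨⟨i1, a2.trans h1, i2, Or.inr (Or.inr ⟨a3.trans h6, b5.trans h5, ?_⟩)⟩, ?_⟩
      · rw [b2, b3, b4, Nat.sub_add_cancel (by omega)]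
        exact ⟨hS', by omega, by omega, hr, hadj⟩
      · rw [b5, h5, if_neg one_ne_zero, if_neg one_ne_zero]
        omega
    · refine ⟨⟨i1, a2.trans h1, i2, Or.inr (Or.inl ⟨a3.trans h6, b4, ?_⟩)⟩, ?_⟩
      · rw [b2, b3]
        obtain hlc' : σ.reg 4 = σ.reg 2 := by omega
        rw [hlc'] at hS'
        exact hS'.restart hr hadj
      · rw [b4, h5, if_pos rfl, if_neg one_ne_zero]
        omega

/-- The program runs in linear time, decides exchangeability and writes a reconfiguration
sequence. -/
theorem program_spec (R : ChordRep G) {num : V × Bool → ℕ} (hnum : R.IsNumbering num) {s t : V}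
    {P Q : G.Walk s t} (hP : IsShortest P) (hQ : IsShortest Q) :
    ∃ (σ : State) (T : ℕ), Runs program (inputState idx num P Q) σ T ∧
      T ≤ (3 * round.cost + 10) * Fintype.card V ∧
      (σ.reg 0 = 0 ∧ ¬ ChordRep.Exchangeable P Q ∨
        σ.reg 0 = 1 ∧ OutputsReconfSeq idx P Q σ ∧ σ.reg 1 ≤ Fintype.card V) := by
  -- A shortest walk repeats no vertex. This also gives a positive number of vertices, so additive
  -- constants can be absorbed in the time bound.
  have hd : P.length < Fintype.card V := (P.isPath_of_length_eq_dist hP).length_lt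
  obtain ⟨T₁, r₁, t₁⟩ := setup.runs_exec (by simp [setup, Cmd.LoopFree]) (inputState idx num P Q)
  have hI : LoopInv idx num P Q (setup.exec (inputState idx num P Q)) := by
    refine ⟨fun _ _ => rfl, rfl, rfl, Or.inr (Or.inl ⟨rfl, rfl, ?_⟩)⟩
    exact Stage.init hP Q _ _
  have hm : loopMeasure P.length (setup.exec (inputState idx num P Q)) ≤ 3 * P.length := by
    have : (setup.exec (inputState idx num P Q)).reg 5 = 0 := rfl
    rw [loopMeasure, if_pos this]
    omega
  obtain ⟨σ, T₂, r₂, t₂, hJ, hlt⟩ := Cmd.runs_while (x := 2) (y := 1) (c := round)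
    (by simp [round, scan, probe, testAdj, loadEnds, compareEnds, emit, change, output, advance,
      Cmd.LoopFree]) (Inv := LoopInv idx num P Q) (μ := loopMeasure P.length) (by
    intro σ h hxy
    rw [h.length] at hxy
    have e : round.exec σ = if σ.reg 5 < σ.reg 9 then scan.exec σ else emit.exec σ := rfl
    rw [e, h.one]
    split_ifs with h5
    · exact loopInv_scan hnum hP hQ h (by omega) hxy
    · exact loopInv_emit hP hQ h (by omega) hxy) _ hI
  refine ⟨(σ.setReg 0 (σ.reg 6)).setReg 1 (σ.reg 7), _,
    Runs.seq r₁ (Runs.seq r₂ (Runs.seq (Runs.copy 0 6 σ) (Runs.copy 1 7 _))), ?_, ?_⟩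
  · have h1 : (round.cost + 1) * loopMeasure P.length (setup.exec (inputState idx num P Q)) ≤
        (round.cost + 1) * (3 * P.length) := Nat.mul_le_mul_left _ hm
    have h2 : (round.cost + 1) * (3 * P.length) ≤ (round.cost + 1) * (3 * Fintype.card V) :=
      Nat.mul_le_mul_left _ (by omega)
    have h3 : setup.cost = 4 := rfl
    have h4 : (round.cost + 1) * (3 * Fintype.card V) + 7 * Fintype.card V =
      (3 * round.cost + 10) * Fintype.card V := by ring
    omega
  · rw [hJ.length, not_lt] at hlt
    -- At the end no block may be partly changed; then `count_le` leaves at most `l - 1` steps.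
    have key : ∀ {m}, σ.reg 3 < m →
        Stage idx P Q (σ.reg 2) (σ.reg 3) m (σ.reg 7) (σ.arr 4) (σ.arr 5) →
        OutputsReconfSeq idx P Q ((σ.setReg 0 (σ.reg 6)).setReg 1 (σ.reg 7)) ∧
          σ.reg 7 ≤ Fintype.card V := fun hm hS =>
      ⟨hS.done hP hQ hlt, by have := hS.left_le; have := hS.count_le; omega⟩
    rcases hJ.cases with ⟨h6, -, h⟩ | ⟨h6, -, h⟩ | ⟨h6, -, h, h1, h2, h3, -⟩
    · exact Or.inl ⟨h6, h⟩
    · exact Or.inr ⟨h6, key (Nat.lt_succ_self _) h⟩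
    · omega

end CircleSPR

theorem mainTheorem2 :
    ∃ (prog : Cmd) (C : ℕ),
      ∀ (V : Type*) [Fintype V] (G : SimpleGraph V) (R : ChordRep G) (s t : V),
        -- the orientation of a chord does not depend on the shortest path
        (∀ P Q : G.Walk s t, IsShortest P → IsShortest Q →
          ∀ i j : ℕ, 0 < i → i < P.length → 0 < j → j < Q.length → P.getVert i = Q.getVert j →
            R.firstEnd P i = R.firstEnd Q j ∧ R.secondEnd P i = R.secondEnd Q j) ∧
        ∀ P Q : G.Walk s t, IsShortest P → IsShortest Q →
          -- reconfigurability is equality of labels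
          (∀ e₁ e₂ : Circle, R.IsEquator s t e₁ e₂ →
            (Reconfigurable P Q ↔ R.label e₁ e₂ P = R.label e₁ e₂ Q)) ∧
          -- reconfiguration sequences of linear length
          (Reconfigurable P Q → ∃ (k : ℕ) (W : ℕ → G.Walk s t),
            IsReconfSeq k W P Q ∧ k ≤ C * Fintype.card V) ∧
          -- the linear-time algorithm
          (∀ (idx : V ≃ Fin (Fintype.card V)) (num : V × Bool → ℕ), R.IsNumbering num →
            ∃ (σ : State) (T : ℕ), Runs prog (inputState idx num P Q) σ T ∧
              T ≤ C * Fintype.card V ∧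
              (Reconfigurable P Q → σ.reg 0 = 1 ∧ OutputsReconfSeq idx P Q σ) ∧
              (¬ Reconfigurable P Q → σ.reg 0 = 0)) := by
  refine ⟨program, 3 * round.cost + 10, fun V _ G R s t => ⟨?_, fun P Q hP hQ => ?_⟩⟩
  · intro P Q hP hQ i j h0 hi _ hj h
    obtain rfl := hP.index_eq hQ hi.le hj.le h
    exact R.firstEnd_congr hP hQ h0 hi h
  -- Exchangeability links all claims: equal labels for a single equator imply it, it yields a short
  -- sequence, and a sequence yields equal labels for every equator.
  · have hshort : ChordRep.Exchangeable P Q → ∃ (k : ℕ) (W : ℕ → G.Walk s t),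
        IsReconfSeq k W P Q ∧ k ≤ Fintype.card V := by
      intro hE
      -- The program is run on an arbitrary numbering to obtain the sequence from its output.
      obtain ⟨num, hnum⟩ := R.exists_isNumbering
      obtain ⟨σ, T, -, -, ⟨-, h⟩ | ⟨-, ⟨W, hW, -⟩, hk⟩⟩ :=
        program_spec (idx := Fintype.equivFin V) R hnum hP hQ
      · exact absurd hE h
      · exact ⟨_, W, hW, hk⟩
    refine ⟨fun e₁ e₂ he => ⟨fun h => ChordRep.label_eq_of_reconfigurable h he, fun h => ?_⟩,
      fun h => ?_, fun idx num hnum => ?_⟩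
    · obtain ⟨k, W, hW, -⟩ := hshort (ChordRep.exchangeable_of_label_eq hP hQ he h)
      exact ⟨k, W, hW⟩
    · obtain ⟨k, W, hW, hk⟩ := hshort (ChordRep.exchangeable_of_reconfigurable R hP hQ h)
      exact ⟨k, W, hW, hk.trans (Nat.le_mul_of_pos_left _ (by omega))⟩
    · obtain ⟨σ, T, hr, hT, h⟩ := program_spec (idx := idx) R hnum hP hQ
      refine ⟨σ, T, hr, hT, fun hR => ?_, fun hR => ?_⟩
      · rcases h with ⟨-, h⟩ | ⟨h, h', -⟩
        · exact absurd (ChordRep.exchangeable_of_reconfigurable R hP hQ hR) h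
        · exact ⟨h, h'⟩
      · rcases h with ⟨h, -⟩ | ⟨-, ⟨W, hW, -⟩, -⟩
        · exact h
        · exact absurd ⟨_, W, hW⟩ hR
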